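/- For a group $G$ let $\mathrm{Hol}(G)=G\rtimes\mathrm{Aut}(G)$ be its holomorph, let $C_k$ be the cyclic group of order $k$, and write $x^y=y^{-1}xy$, $(x,y)=x^{-1}y^{-1}xy$. **(1)** Let $p$ be an odd prime, $m\ge 2$ and $n\ge 0$. Put $y=p^m$, $t=p^{m-1}$, and let $1^k$ denote the elementary abelian group of order $p^k$. Then $\mathrm{Hol}(C_y\times 1^n)$ has the structure $$[1^{n+1}\times 1^{n+1}]\cdot[\mathrm{Hol}(1^n)\times\mathrm{Hol}(C_t)]$$ in the following sense. There are subgroups $A,B,H,K$ of $\mathrm{Hol}(C_y\times 1^n)$ such that * $A\cong B\cong 1^{n+1}$, $A\cap B=1$, and $A$ and $B$ centralize each other, so that $N=AB=A\times B$; * $N$ is normal, and there is a surjective homomorphism $\pi:\mathrm{Hol}(C_y\times 1^n)\to \mathrm{Hol}(1^n)\times\mathrm{Hol}(C_t)$ with kernel $N$ that maps $H$ isomorphically onto $\mathrm{Hol}(1^n)\times 1$ and satisfies $\pi(K)=1\times\mathrm{Hol}(C_t)$; * the extension is not a semidirect product: $N$ has no complement in $\mathrm{Hol}(C_y\times 1^n)$;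 * $H$ and $K$ centralize each other; * $H$ normalizes $A$ and $B$, acts faithfully on $A$ by conjugation, and acts in the same way on both: there is an $H$-equivariant isomorphism $A\to B$. **(2)** Let $p=3$, $n=1$, $m\ge 2$. Then $\mathrm{Hol}(C_{3^m}\times C_3)$ is presented by generators $a,b,c,d,e,f,e_1,f_1$ and the relations * $a^3=b^3=c^3=d^3=(a,b)=(a,c)=(a,d)=(b,c)=(b,d)=(c,d)=1$; * $e_1^3=f_1^2=e_1^{f_1}e_1=1$; * $a^{e_1}a^{-1}b^{-1}=(b,e_1)=a^{f_1}a=(b,f_1)=c^{e_1}c^{-1}d^{-1}=(d,e_1)=c^{f_1}c=(d,f_1)=1$; * $e^{3^m}=f^{2\cdot 3^{m-1}}=e^fe^4=1$; * $e^{3^{m-1}}b=d^{-1}f^{2\cdot 3^{m-2}}=(e,e_1)=(e,f_1)=(f,e_1)=(f,f_1)=1$; * $(a,e)=c^e a c^{-1}=a^fa=(c,f)=(b,e)=d^e b d^{-1}=b^fb=(d,f)=1$. It is also presented by the same generators and relations when $e^fe^4$ is replaced by $e^fe^{-2}$ and $d^{-1}f^{2\cdot3^{m-2}}$ by $d^{-1}f^{4\cdot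 3^{m-2}}$. In both presentations the isomorphism can be chosen so that the subgroups $A=\langle a,b\rangle$, $B=\langle c,d\rangle$, $H=\langle e_1,f_1\rangle$, $K=\langle e,f\rangle$ have all the properties listed in (1). -/

import Mathlib

namespace Holomorph

/-- The holomorph of `G`: the semidirect product of `G` with its full automorphism group,
which acts on `G` in the tautological way. -/
abbrev Hol (G : Type) [Group G] : Type :=
  G ⋊[MonoidHom.id (MulAut G)] MulAut G

/-- The cyclic group of order `k` (for `k ≠ 0`), written multiplicatively. -/
abbrev Cyc (k : ℕ) : Type := Multiplicative (ZMod k)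

/-- `1^n`: the elementary abelian group of order `p ^ n`. -/
abbrev Elem (p n : ℕ) : Type := Fin n → Cyc p

/-- The abelian group `C_y × 1^n` with `y = p ^ m`. -/
abbrev Base (p m n : ℕ) : Type := Cyc (p ^ m) × Elem p n

/-- The subgroups `A`, `B`, `H`, `K` exhibit the structure
`[1^(n+1) × 1^(n+1)] · [Hol(1^n) × Hol(C_t)]`, `t = p ^ (m - 1)`, on the holomorph of
`C_y × 1^n`, `y = p ^ m`.  The normal subgroup is `A × B = A ⊔ B`. -/
structure IsDecomposition (p m n : ℕ) (A B H K : Subgroup (Hol (Base p m n))) : Prop where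
  /-- `A` is elementary abelian of order `p ^ (n + 1)`. -/
  equiv_left : Nonempty (A ≃* Elem p (n + 1))
  /-- `B` is elementary abelian of order `p ^ (n + 1)`. -/
  equiv_right : Nonempty (B ≃* Elem p (n + 1))
  /-- Together with the next field: `A ⊔ B` is the internal direct product of `A` and `B`. -/
  disjoint : Disjoint A B
  commute_left_right : ∀ a ∈ A, ∀ b ∈ B, Commute a b
  /-- `A ⊔ B` is normal with quotient `Hol(1^n) × Hol(C_t)`; the subgroup `H` is carried
  isomorphically onto the factor `Hol(1^n)`, and `K` is carried onto the factor `Hol(C_t)`. -/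
  exists_quotient : ∃ π : Hol (Base p m n) →* Hol (Elem p n) × Hol (Cyc (p ^ (m - 1))),
    Function.Surjective π ∧ π.ker = A ⊔ B ∧
    Set.BijOn π (H : Set (Hol (Base p m n))) {x | x.2 = 1} ∧
    Set.SurjOn π (K : Set (Hol (Base p m n))) {x | x.1 = 1} ∧
    Set.MapsTo π (K : Set (Hol (Base p m n))) {x | x.1 = 1}
  /-- The extension is not a semidirect product: `A ⊔ B` has no complement. -/
  not_split : ¬ ∃ C : Subgroup (Hol (Base p m n)), Subgroup.IsComplement' (A ⊔ B) C
  /-- `H` and `K` centralize each other. -/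
  commute_lifts : ∀ h ∈ H, ∀ k ∈ K, Commute h k
  /-- `H` acts on `A` by conjugation ... -/
  conj_left : ∀ h ∈ H, ∀ a ∈ A, h * a * h⁻¹ ∈ A
  /-- ... and on `B` ... -/
  conj_right : ∀ h ∈ H, ∀ b ∈ B, h * b * h⁻¹ ∈ B
  /-- ... faithfully ... -/
  faithful : ∀ h ∈ H, (∀ a ∈ A, h * a * h⁻¹ = a) → h = 1
  /-- ... and in the same way on both factors. -/
  same_action : ∃ θ : A ≃* B, ∀ h (hh : h ∈ H) (a : A),
    (θ ⟨h * a * h⁻¹, conj_left h hh a a.2⟩ : Hol (Base p m n)) = h * (θ a) * h⁻¹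

/-- The generators of the presentation of the holomorph of `C_(3^m) × C_3`. -/
inductive Gen : Type
  | a | b | c | d | e | f | e1 | f1

/-- `x ^ y = y⁻¹ x y`. -/
def cj {G : Type} [Group G] (x y : G) : G := y⁻¹ * x * y

/-- `(x, y) = x⁻¹ y⁻¹ x y`. -/
def cm {G : Type} [Group G] (x y : G) : G := x⁻¹ * y⁻¹ * x * y

/-- The defining relators for the holomorph of `C_(3^m) × C_3`, where the two relators that
occur in two alternative forms are `e^f * e ^ i` and `d⁻¹ * f ^ j`. -/
def relators (m : ℕ) (i : ℤ) (j : ℕ) : Set (FreeGroup Gen) :=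
  let a := FreeGroup.of Gen.a
  let b := FreeGroup.of Gen.b
  let c := FreeGroup.of Gen.c
  let d := FreeGroup.of Gen.d
  let e := FreeGroup.of Gen.e
  let f := FreeGroup.of Gen.f
  let e1 := FreeGroup.of Gen.e1
  let f1 := FreeGroup.of Gen.f1
  -- the elementary abelian group of order 81
  {a ^ 3, b ^ 3, c ^ 3, d ^ 3, cm a b, cm a c, cm a d, cm b c, cm b d, cm c d} ∪
  -- the group `Hol(C_3)`
  {e1 ^ 3, f1 ^ 2, cj e1 f1 * e1} ∪
  -- its action on the elementary abelian group
  {cj a e1 * a⁻¹ * b⁻¹, cm b e1, cj a f1 * a, cm b f1,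
    cj c e1 * c⁻¹ * d⁻¹, cm d e1, cj c f1 * c, cm d f1} ∪
  -- the part `Hol(C_t)`
  {e ^ (3 ^ m), f ^ (2 * 3 ^ (m - 1)), cj e f * e ^ i} ∪
  -- its powers in the elementary abelian group, and its actions
  {e ^ (3 ^ (m - 1)) * b, d⁻¹ * f ^ j,
    cm e e1, cm e f1, cm f e1, cm f f1,
    cm a e, cj c e * a * c⁻¹, cj a f * a,
    cm c f, cm b e, cj d e * b * d⁻¹, cj b f * b, cm d f}

/-- The group with these generators and relators is the holomorph of `C_(3^m) × C_3`, with
`A = ⟨a, b⟩`, `B = ⟨c, d⟩`, `H = ⟨e1, f1⟩`, `K = ⟨e, f⟩` in the structure above. -/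
def IsPresentation (m : ℕ) (i : ℤ) (j : ℕ) : Prop :=
  ∃ Φ : PresentedGroup (relators m i j) ≃* Hol (Base 3 m 1),
    IsDecomposition 3 m 1
      (Subgroup.closure {Φ (PresentedGroup.of Gen.a), Φ (PresentedGroup.of Gen.b)})
      (Subgroup.closure {Φ (PresentedGroup.of Gen.c), Φ (PresentedGroup.of Gen.d)})
      (Subgroup.closure {Φ (PresentedGroup.of Gen.e1), Φ (PresentedGroup.of Gen.f1)})
      (Subgroup.closure {Φ (PresentedGroup.of Gen.e), Φ (PresentedGroup.of Gen.f)})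

end Holomorph

/-! Put `m = k + 2`. An endomorphism of `C_y × 1^n` is a block matrix `(scale, row, col, mat)`:
homomorphisms from `1^n` to `C_y` land in the subgroup of order `p`, and homomorphisms from `C_y` to
`1^n` factor through reduction mod `p`. Since `m ≥ 2`, that subgroup vanishes mod `p`. Hence `mat`
is multiplicative, and `scale` is multiplicative modulo `t = p ^ (k + 1)`.

This gives two homomorphisms on the holomorph. One sends an affine map to its translation part and
multiplier on the cyclic factor, both mod `t`. The other forgets translations and keeps the affine
pair `(row · mat⁻¹, scale · mat⁻ᵀ)`, an element of `Hol(1^n)`. Their common kernel is the product of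
`A`, the translations of order dividing `p`, and `B`, the automorphisms `(1 + p ^ (k + 1) b, 0, col,
1)`. For `H` take the automorphisms `(1, row, 0, mat)`, which lift `Hol(1^n)`; for `K` take
translations along `C_y` with scalar automorphisms, a copy of `Hol(C_y)` covering `Hol(C_t)`. A
complement of `A × B` would contain a lift of the generating translation of `C_t` of order dividing
`t`; `elt_pow_coords` and `pow_ne_one` show that for odd `p` the `t`-th power of every such lift is
nontrivial.

For the presentation, explicit generators satisfy the relations (`genRelations_genElt`), so the
presented group maps to the holomorph, onto by the structure above. The relations bring every word
to the form (word in `a, b, c, d`) · `e1 ^ r * f1 ^ s` · `e ^ x * f ^ y` (`lift_mem`), and a word of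
this form with trivial image is already trivial by the relations (`eq_one_of_map`). The two variants
come from the multipliers `-4` and `2`, both primitive roots mod `3 ^ m` with a power equal to `16 ^
3 ^ k = 1 - 3 ^ (k + 1)`. -/

namespace Holomorph

open Matrix

/-! ### Automorphism groups as unit groups of parametrized endomorphism monoids -/

section AutEquiv

/-- A parametrization of the endomorphism monoid of `X` by a monoid `M`. -/
structure EndParam (M X : Type*) [Monoid M] [AddCommGroup X] extends M ≃ (X →+ X) where
  map_one' : toFun 1 = AddMonoidHom.id X
  map_mul' : ∀ c d, toFun (c * d) = (toFun c).comp (toFun d)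

variable {M X G : Type*} [Monoid M] [AddCommGroup X] [Group G]

/-- The endomorphism with a given parameter. -/
def EndParam.act (r : EndParam M X) (c : M) : X →+ X := r.toEquiv c

theorem EndParam.act_one (r : EndParam M X) (x : X) : r.act 1 x = x :=
  DFunLike.congr_fun r.map_one' x

theorem EndParam.act_mul (r : EndParam M X) (c d : M) (x : X) :
    r.act (c * d) x = r.act c (r.act d x) :=
  DFunLike.congr_fun (r.map_mul' c d) x

theorem EndParam.act_symm (r : EndParam M X) (f : X →+ X) : r.act (r.toEquiv.symm f) = f :=
  r.toEquiv.apply_symm_apply f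

theorem EndParam.ext_act (r : EndParam M X) {c d : M} (h : ∀ x, r.act c x = r.act d x) : c = d :=
  r.toEquiv.injective (AddMonoidHom.ext h)

/-- If the endomorphisms of `X` are parametrized by a monoid `M`, the automorphisms of a
multiplicative copy of `X` are parametrized by the units of `M`. -/
def autEquiv (e : Multiplicative X ≃* G) (r : EndParam M X) : Mˣ ≃* MulAut G where
  toFun c :=
    { toFun := fun g => e (.ofAdd (r.act c (e.symm g).toAdd))
      invFun := fun g => e (.ofAdd (r.act ↑c⁻¹ (e.symm g).toAdd))
      left_inv := fun g => by simp [← r.act_mul, r.act_one]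
      right_inv := fun g => by simp [← r.act_mul, r.act_one]
      map_mul' := fun g h => by simp }
  invFun φ :=
    let s (φ : MulAut G) : X →+ X :=
      AddMonoidHom.mk' (fun x => (e.symm (φ (e (.ofAdd x)))).toAdd) (by intro x y; simp)
    { val := r.toEquiv.symm (s φ)
      inv := r.toEquiv.symm (s φ⁻¹)
      val_inv := r.ext_act fun x => by simp [r.act_mul, r.act_symm, r.act_one, s]
      inv_val := r.ext_act fun x => by simp [r.act_mul, r.act_symm, r.act_one, s] }
  left_inv c := by
    ext
    apply r.ext_act
    intro x
    simp [r.act_symm]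
  right_inv φ := by
    ext g
    simp [r.act_symm]
  map_mul' c d := by
    ext g
    simp [r.act_mul]

theorem autEquiv_apply (e : Multiplicative X ≃* G) (r : EndParam M X) (c : Mˣ) (x : X) :
    autEquiv e r c (e (.ofAdd x)) = e (.ofAdd (r.act c x)) := by
  simp [autEquiv]

end AutEquiv

/-- The endomorphisms of `ZMod k` are the multiplications. -/
def zmodEnd (k : ℕ) : EndParam (ZMod k) (ZMod k) where
  toFun := AddMonoidHom.mulLeft
  invFun f := f 1
  left_inv x := by simp
  right_inv f := by
    apply AddMonoidHom.ext
    intro x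
    obtain ⟨x, rfl⟩ := ZMod.intCast_surjective x
    rw [AddMonoidHom.coe_mulLeft, mul_comm, ← zsmul_eq_mul, ← map_zsmul, zsmul_one]
  map_one' := by ext; simp
  map_mul' x y := by
    apply AddMonoidHom.ext
    intro z
    simp [mul_assoc]

@[simp] theorem zmodEnd_act (k : ℕ) (x y : ZMod k) : (zmodEnd k).act x y = x * y := rfl

/-- `F_p^n`, written additively. -/
abbrev Vec (p n : ℕ) : Type := Fin n → ZMod p

/-- The endomorphisms of `F_p^n` are the matrices. -/
def vecEnd (p n : ℕ) : EndParam (Matrix (Fin n) (Fin n) (ZMod p)) (Vec p n) where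
  toFun M := AddMonoidHom.mk' (fun v => M *ᵥ v) (mulVec_add M)
  invFun f := LinearMap.toMatrix' (AddMonoidHom.toZModLinearMap p f)
  left_inv M := by
    apply Matrix.toLin'.injective
    rw [Matrix.toLin'_toMatrix']
    ext; simp
  right_inv f := by
    apply AddMonoidHom.ext
    intro v
    rw [AddMonoidHom.mk'_apply, LinearMap.toMatrix'_mulVec, AddMonoidHom.coe_toZModLinearMap]
  map_one' := by
    apply AddMonoidHom.ext
    intro v
    simp
  map_mul' M N := by
    apply AddMonoidHom.ext
    intro v
    simp [mulVec_mulVec]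

@[simp] theorem vecEnd_act (p n : ℕ) (M : Matrix (Fin n) (Fin n) (ZMod p)) (v : Vec p n) :
    (vecEnd p n).act M v = M *ᵥ v := rfl

/-- `F_p^n`, written multiplicatively. -/
def vecEquiv (p n : ℕ) : Multiplicative (Vec p n) ≃* Elem p n where
  toFun v i := .ofAdd (v.toAdd i)
  invFun v := .ofAdd fun i => (v i).toAdd
  left_inv _ := rfl
  right_inv _ := rfl
  map_mul' _ _ := rfl

/-! ### Reductions of `ZMod (p ^ (k + 2))` and its subgroup of order `p` -/

section Scalars

variable (p k : ℕ)

/-- Reduction modulo `p`. -/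
def red : ZMod (p ^ (k + 2)) →+* ZMod p := ZMod.castHom (dvd_pow_self p (by omega)) _

/-- Reduction modulo `p ^ (k + 1)`. -/
def redT : ZMod (p ^ (k + 2)) →+* ZMod (p ^ (k + 1)) :=
  ZMod.castHom (pow_dvd_pow p (by omega)) _

/-- The embedding of `F_p` as the subgroup of order `p` of `ZMod (p ^ (k + 2))`. -/
def incl : ZMod p →+ ZMod (p ^ (k + 2)) :=
  ZMod.lift p ⟨zmultiplesHom _ ((p : ZMod (p ^ (k + 2))) ^ (k + 1)), by
    simp only [zmultiplesHom_apply, natCast_zsmul, nsmul_eq_mul]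
    rw [← pow_succ', ← Nat.cast_pow, ZMod.natCast_self]⟩

variable {p k}

theorem incl_intCast (c : ℤ) : incl p k c = c * (p : ZMod (p ^ (k + 2))) ^ (k + 1) := by
  simp [incl]

/-- The multiples of `p ^ (k + 1)` form an ideal killed by `p`, so the ring acts on it through
reduction mod `p`. With `red_incl`, products of two of its elements vanish. -/
theorem incl_mul (c : ZMod p) (x : ZMod (p ^ (k + 2))) :
    incl p k c * x = incl p k (c * red p k x) := by
  obtain ⟨c, rfl⟩ := ZMod.intCast_surjective c
  obtain ⟨x, rfl⟩ := ZMod.intCast_surjective x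
  rw [map_intCast (red p k), ← Int.cast_mul, incl_intCast, incl_intCast]
  push_cast
  ring

@[simp] theorem red_incl (c : ZMod p) : red p k (incl p k c) = 0 := by
  obtain ⟨c, rfl⟩ := ZMod.intCast_surjective c
  rw [incl_intCast]
  simp

@[simp] theorem redT_incl (c : ZMod p) : redT p k (incl p k c) = 0 := by
  obtain ⟨c, rfl⟩ := ZMod.intCast_surjective c
  rw [incl_intCast, map_mul, map_pow, map_natCast, ← Nat.cast_pow, ZMod.natCast_self, mul_zero]

theorem redT_surjective : Function.Surjective (redT p k) :=
  ZMod.castHom_surjective (pow_dvd_pow p (by omega))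

variable [Fact p.Prime]

theorem incl_injective : Function.Injective (incl p k) := by
  rw [injective_iff_map_eq_zero]
  intro c h
  obtain ⟨c, rfl⟩ := ZMod.intCast_surjective c
  have hp := (Fact.out : p.Prime).pos
  rw [incl_intCast, ← Int.cast_natCast, ← Int.cast_pow, ← Int.cast_mul,
    ZMod.intCast_zmod_eq_zero_iff_dvd] at h
  rw [ZMod.intCast_zmod_eq_zero_iff_dvd]
  push_cast at h
  rw [pow_succ' _ (k + 1)] at h
  exact Int.dvd_of_mul_dvd_mul_right (by positivity) h

@[simp] theorem incl_eq_zero {c : ZMod p} : incl p k c = 0 ↔ c = 0 :=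
  map_eq_zero_iff _ incl_injective

theorem exists_incl_of_redT {x : ZMod (p ^ (k + 2))} (h : redT p k x = 0) :
    ∃ c, incl p k c = x := by
  obtain ⟨x, rfl⟩ := ZMod.intCast_surjective x
  rw [map_intCast, ZMod.intCast_zmod_eq_zero_iff_dvd] at h
  obtain ⟨c, rfl⟩ := h
  refine ⟨c, ?_⟩
  rw [incl_intCast]
  push_cast
  ring

theorem exists_incl_of_mul {x : ZMod (p ^ (k + 2))} (h : p * x = 0) : ∃ c, incl p k c = x := by
  apply exists_incl_of_redT
  obtain ⟨x, rfl⟩ := ZMod.intCast_surjective x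
  have hp := (Fact.out : p.Prime).pos
  rw [← Int.cast_natCast, ← Int.cast_mul, ZMod.intCast_zmod_eq_zero_iff_dvd] at h
  rw [map_intCast, ZMod.intCast_zmod_eq_zero_iff_dvd]
  push_cast at h ⊢
  rw [pow_succ' _ (k + 1)] at h
  exact Int.dvd_of_mul_dvd_mul_left (by positivity) h

theorem red_eq_of_redT {x y : ZMod (p ^ (k + 2))} (h : redT p k x = redT p k y) :
    red p k x = red p k y := by
  rw [← sub_eq_zero, ← map_sub] at h ⊢
  obtain ⟨c, hc⟩ := exists_incl_of_redT h
  rw [← hc, red_incl]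

end Scalars

end Holomorph

/-! ### Endomorphisms of `C_y × 1^n` as block matrices -/

namespace Holomorph

open Matrix

/-- The coefficients of the endomorphism
`(x, v) ↦ (scale * x + p ^ (k + 1) * (row ⬝ v), x * col + mat v)` of `ZMod (p ^ (k + 2)) × F_p^n`. -/
@[ext] structure Coef (p k n : ℕ) where
  /-- The action on the cyclic factor. -/
  scale : ZMod (p ^ (k + 2))
  /-- The map from the elementary abelian to the cyclic factor. -/
  row : Vec p n
  /-- The map from the cyclic to the elementary abelian factor. -/
  col : Vec p n
  /-- The action on the elementary abelian factor. -/
  mat : Matrix (Fin n) (Fin n) (ZMod p)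

variable {p k n : ℕ}

namespace Coef

instance : One (Coef p k n) := ⟨⟨1, 0, 0, 1⟩⟩

instance : Mul (Coef p k n) :=
  ⟨fun c d => ⟨c.scale * d.scale + incl p k (c.row ⬝ᵥ d.col),
    red p k c.scale • d.row + c.row ᵥ* d.mat, red p k d.scale • c.col + c.mat *ᵥ d.col,
    c.mat * d.mat⟩⟩

@[simp] theorem one_scale : (1 : Coef p k n).scale = 1 := rfl
@[simp] theorem one_row : (1 : Coef p k n).row = 0 := rfl
@[simp] theorem one_col : (1 : Coef p k n).col = 0 := rfl
@[simp] theorem one_mat : (1 : Coef p k n).mat = 1 := rfl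

@[simp] theorem mul_scale (c d : Coef p k n) :
    (c * d).scale = c.scale * d.scale + incl p k (c.row ⬝ᵥ d.col) := rfl
@[simp] theorem mul_row (c d : Coef p k n) :
    (c * d).row = red p k c.scale • d.row + c.row ᵥ* d.mat := rfl
@[simp] theorem mul_col (c d : Coef p k n) :
    (c * d).col = red p k d.scale • c.col + c.mat *ᵥ d.col := rfl
@[simp] theorem mul_mat (c d : Coef p k n) : (c * d).mat = c.mat * d.mat := rfl

/-- The endomorphism with given coefficients. -/
def app (c : Coef p k n) : ZMod (p ^ (k + 2)) × Vec p n →+ ZMod (p ^ (k + 2)) × Vec p n :=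
  AddMonoidHom.mk'
    (fun x => (c.scale * x.1 + incl p k (c.row ⬝ᵥ x.2), red p k x.1 • c.col + c.mat *ᵥ x.2)) <| by
      intro x y
      simp only [Prod.fst_add, Prod.snd_add, mul_add, dotProduct_add, map_add, mulVec_add, add_smul,
        Prod.mk_add_mk]
      congr 1 <;> abel

@[simp] theorem app_fst (c : Coef p k n) (x : ZMod (p ^ (k + 2)) × Vec p n) :
    (c.app x).1 = c.scale * x.1 + incl p k (c.row ⬝ᵥ x.2) := rfl

@[simp] theorem app_snd (c : Coef p k n) (x : ZMod (p ^ (k + 2)) × Vec p n) :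
    (c.app x).2 = red p k x.1 • c.col + c.mat *ᵥ x.2 := rfl

theorem app_one : (1 : Coef p k n).app = AddMonoidHom.id _ := by
  apply AddMonoidHom.ext
  intro x
  ext <;> simp

/-- The composite of a `row` with a `col` through `C_y` is zero by `red_incl`, so the matrix parts
simply multiply; the composite through `1^n` only alters `scale` by a multiple of `p ^ (k + 1)`. -/
theorem app_mul (c d : Coef p k n) : (c * d).app = c.app.comp d.app := by
  apply AddMonoidHom.ext
  intro x
  refine Prod.ext ?_ ?_
  · simp only [app_fst, mul_scale, mul_row, AddMonoidHom.comp_apply, app_snd, dotProduct_add,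
      add_dotProduct, dotProduct_smul, smul_dotProduct, map_add, add_mul, mul_add, mul_assoc,
      incl_mul, smul_eq_mul, dotProduct_mulVec, mul_comm c.scale (incl _ _ _)]
    rw [mul_comm (red p k x.1), mul_comm (red p k c.scale)]
    abel
  · simp [mulVec_add, mulVec_smul, smul_add, mulVec_mulVec, smul_smul, mul_comm, add_assoc]

variable [Fact p.Prime]

theorem app_injective : Function.Injective (app : Coef p k n → _) := by
  intro c d h
  have h1 (x) := DFunLike.congr_fun h x
  have e1 := h1 (1, 0)
  simp only [Prod.ext_iff, app_fst, app_snd] at e1 h1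
  simp only [dotProduct_zero, mulVec_zero, map_zero, map_one, one_smul, add_zero, mul_one] at e1
  refine Coef.ext e1.1 ?_ e1.2 ?_
  · refine dotProduct_eq _ _ fun v => incl_injective (k := k) ?_
    simpa using (h1 (0, v)).1
  · refine Matrix.mulVec_injective (funext fun v => ?_)
    simpa using (h1 (0, v)).2

/-- The image of `(1, 0)` supplies `scale` and `col`. The first coordinate of the image of `(0, v)`
is killed by `p`, hence lies in the image of `incl`; this yields a linear functional, represented by
`row`. -/
theorem app_surjective : Function.Surjective (app : Coef p k n → _) := by
  intro f
  have hs (x : ZMod (p ^ (k + 2))) : f (x, 0) = x.val • f (1, 0) := by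
    conv_lhs => rw [← ZMod.natCast_zmod_val x, ← nsmul_one (ZMod.val x)]
    rw [← map_nsmul]; simp
  have hr (v : Vec p n) : ∃ c, incl p k c = (f (0, v)).1 := by
    apply exists_incl_of_mul
    rw [← nsmul_eq_mul, ← Prod.smul_fst, ← map_nsmul]
    have : p • ((0, v) : ZMod (p ^ (k + 2)) × Vec p n) = 0 := by
      ext <;> simp
    simp [this]
  choose r hr using hr
  let r' : Vec p n →+ ZMod p := AddMonoidHom.mk' r fun v w => incl_injective (k := k) <| by
    rw [map_add, hr, hr, hr, ← Prod.fst_add, ← map_add]; simp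
  have hf (v) (w : Vec p n) : f (v, w) = v.val • f (1, 0) + f (0, w) := by
    rw [← hs, ← map_add]; simp
  obtain ⟨w, hw⟩ := (dotProductEquiv (ZMod p) (Fin n)).surjective (AddMonoidHom.toZModLinearMap p r')
  let m : Vec p n →+ Vec p n := (AddMonoidHom.snd _ _).comp (f.comp (AddMonoidHom.inr _ _))
  refine ⟨⟨(f (1, 0)).1, w, (f (1, 0)).2, (vecEnd p n).toEquiv.symm m⟩, ?_⟩
  apply AddMonoidHom.ext
  rintro ⟨x, v⟩
  have hw' : w ⬝ᵥ v = r v := DFunLike.congr_fun hw v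
  have hm : (vecEnd p n).toEquiv.symm m *ᵥ v = (f (0, v)).2 :=
    DFunLike.congr_fun ((vecEnd p n).act_symm m) v
  rw [hf x v]
  refine Prod.ext ?_ ?_
  · simp [hw', hr, mul_comm]
  · simp only [app_snd, hm, Prod.snd_add, Prod.smul_snd]
    congr 1
    conv_lhs => rw [← ZMod.natCast_zmod_val x]
    rw [map_natCast, Nat.cast_smul_eq_nsmul]

instance : Monoid (Coef p k n) where
  mul_assoc a b c := app_injective <| by simp only [app_mul]; rfl
  one_mul a := app_injective <| by simp only [app_mul, app_one]; rfl
  mul_one a := app_injective <| by simp only [app_mul, app_one]; rfl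

end Coef

variable [Fact p.Prime]

/-- Every endomorphism of `ZMod (p ^ (k + 2)) × F_p^n` is given by its coefficients. -/
noncomputable def coefEnd (p k n : ℕ) [Fact p.Prime] :
    EndParam (Coef p k n) (ZMod (p ^ (k + 2)) × Vec p n) where
  toEquiv := Equiv.ofBijective Coef.app ⟨Coef.app_injective, Coef.app_surjective⟩
  map_one' := Coef.app_one
  map_mul' := Coef.app_mul

@[simp] theorem coefEnd_act (c : Coef p k n) (x : ZMod (p ^ (k + 2)) × Vec p n) :
    (coefEnd p k n).act c x = c.app x := rfl

/-- The base group, written additively. -/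
def baseEquiv (p k n : ℕ) :
    Multiplicative (ZMod (p ^ (k + 2)) × Vec p n) ≃* Base p (k + 2) n where
  toFun x := (.ofAdd x.toAdd.1, vecEquiv p n (.ofAdd x.toAdd.2))
  invFun x := .ofAdd (x.1.toAdd, ((vecEquiv p n).symm x.2).toAdd)
  left_inv _ := rfl
  right_inv _ := rfl
  map_mul' _ _ := rfl

end Holomorph

/-! ### The holomorph in coordinates; projections, kernel factors and lifts -/

namespace Holomorph

open Matrix

section Elt

variable {M X : Type*} {G : Type} [Monoid M] [AddCommGroup X] [Group G]
  (e : Multiplicative X ≃* G) (r : EndParam M X)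

/-- The element of the holomorph with translation part `x` and linear part `c`. -/
def elt (x : X) (c : Mˣ) : Hol G := ⟨e (.ofAdd x), autEquiv e r c⟩

theorem elt_mul (x y : X) (c d : Mˣ) :
    elt e r x c * elt e r y d = elt e r (x + r.act c y) (c * d) := by
  ext : 1
  · simp [elt, autEquiv_apply, ofAdd_add]
  · simp [elt]

theorem elt_zero_one : elt e r 0 1 = 1 := by
  ext : 1 <;> simp [elt]

variable {e r}

theorem elt_inj {x y : X} {c d : Mˣ} : elt e r x c = elt e r y d ↔ x = y ∧ c = d := by
  simp [elt, SemidirectProduct.ext_iff]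

theorem elt_eq_one {x : X} {c : Mˣ} : elt e r x c = 1 ↔ x = 0 ∧ c = 1 := by
  rw [← elt_zero_one e r, elt_inj]

variable (e r)

theorem exists_elt (g : Hol G) : ∃ x c, elt e r x c = g :=
  ⟨(e.symm g.left).toAdd, (autEquiv e r).symm g.right, by ext : 1 <;> simp [elt]⟩

/-- A homomorphism on the holomorph, defined in coordinates. -/
def eltLift {H : Type*} [MulOneClass H] (F : X → Mˣ → H) (h1 : F 0 1 = 1)
    (hF : ∀ x y (c d : Mˣ), F (x + r.act c y) (c * d) = F x c * F y d) : Hol G →* H where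
  toFun g := F (e.symm g.left).toAdd ((autEquiv e r).symm g.right)
  map_one' := by simpa using h1
  map_mul' g h := by
    obtain ⟨x, c, rfl⟩ := exists_elt e r g
    obtain ⟨y, d, rfl⟩ := exists_elt e r h
    rw [elt_mul]
    simpa [elt] using hF x y c d

@[simp] theorem eltLift_elt {H : Type*} [MulOneClass H] (F : X → Mˣ → H) (h1 : F 0 1 = 1)
    (hF : ∀ x y (c d : Mˣ), F (x + r.act c y) (c * d) = F x c * F y d) (x : X) (c : Mˣ) :
    eltLift e r F h1 hF (elt e r x c) = F x c := by
  simp [eltLift, elt]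

end Elt

variable {p k n : ℕ}

/-- Elements of `Hol(C_k)` in coordinates. -/
abbrev cycElt (k : ℕ) (x : ZMod k) (c : (ZMod k)ˣ) : Hol (Cyc k) :=
  elt (MulEquiv.refl _) (zmodEnd k) x c

/-- Elements of `Hol(1^n)` in coordinates. -/
abbrev elemElt (x : Vec p n) (c : (Matrix (Fin n) (Fin n) (ZMod p))ˣ) : Hol (Elem p n) :=
  elt (vecEquiv p n) (vecEnd p n) x c

variable [Fact p.Prime]

/-- Elements of the holomorph of the base group in coordinates. -/
noncomputable abbrev baseElt (x : ZMod (p ^ (k + 2)) × Vec p n) (c : (Coef p k n)ˣ) :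
    Hol (Base p (k + 2) n) :=
  elt (baseEquiv p k n) (coefEnd p k n) x c

/-- The multiplier on the cyclic factor, modulo `p ^ (k + 1)`. -/
def scaleRedT : Coef p k n →* ZMod (p ^ (k + 1)) where
  toFun c := redT p k c.scale
  map_one' := by simp
  map_mul' c d := by simp

/-- The contragredient of the matrix part, twisted by the multiplier on the cyclic factor. -/
def dualMat : (Coef p k n)ˣ →* (Matrix (Fin n) (Fin n) (ZMod p))ˣ :=
  MonoidHom.toHomUnits
    -- Inversion and transposition each reverse products, so together they preserve them. The scalar
    -- factor makes scalar automorphisms act trivially.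
    { toFun := fun c => red p k c.val.scale • c⁻¹.val.matᵀ
      map_one' := by simp
      map_mul' := fun c d => by simp [transpose_mul, smul_smul, mul_comm] }

theorem dualMat_val (c : (Coef p k n)ˣ) :
    (dualMat c).val = red p k c.val.scale • c⁻¹.val.matᵀ := rfl

theorem mat_mul_inv (c : (Coef p k n)ˣ) : c.val.mat * c⁻¹.val.mat = 1 := by
  rw [← Coef.mul_mat, Units.mul_inv, Coef.one_mat]

theorem mat_inv_mul (c : (Coef p k n)ˣ) : c⁻¹.val.mat * c.val.mat = 1 := by
  rw [← Coef.mul_mat, Units.inv_mul, Coef.one_mat]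

/-- The projection of the holomorph of the base group to `Hol(1^n)`. -/
noncomputable def projElem : Hol (Base p (k + 2) n) →* Hol (Elem p n) :=
  eltLift (baseEquiv p k n) (coefEnd p k n)
    (fun _ c => elemElt (c.val.row ᵥ* c⁻¹.val.mat) (dualMat c))
    (by simp [elt_eq_one]) <| by
      intro x y c d
      rw [elt_mul, elt_inj]
      refine ⟨?_, map_mul _ _ _⟩
      rw [vecEnd_act, dualMat_val, smul_mulVec, mulVec_transpose, vecMul_vecMul, Units.val_mul,
        Coef.mul_row, _root_.mul_inv_rev, Units.val_mul, Coef.mul_mat, add_vecMul, smul_vecMul,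
        vecMul_vecMul, ← mul_assoc, mat_mul_inv, one_mul, add_comm]

/-- The projection of the holomorph of the base group to `Hol(C_t)`. -/
noncomputable def projCyc : Hol (Base p (k + 2) n) →* Hol (Cyc (p ^ (k + 1))) :=
  eltLift (baseEquiv p k n) (coefEnd p k n)
    (fun x c => cycElt _ (redT p k x.1) (Units.map scaleRedT c))
    (by simp [elt_eq_one]) <| by
      intro x y c d
      rw [elt_mul, elt_inj]
      simp [scaleRedT]

@[simp] theorem projElem_elt (x : ZMod (p ^ (k + 2)) × Vec p n) (c : (Coef p k n)ˣ) :
    projElem (baseElt x c) = elemElt (c.val.row ᵥ* c⁻¹.val.mat) (dualMat c) :=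
  eltLift_elt ..

@[simp] theorem projCyc_elt (x : ZMod (p ^ (k + 2)) × Vec p n) (c : (Coef p k n)ˣ) :
    projCyc (baseElt x c) = cycElt _ (redT p k x.1) (Units.map scaleRedT c) :=
  eltLift_elt ..

/-- The translations of order `p`. -/
noncomputable def transHom : Multiplicative (Vec p (n + 1)) →* Hol (Base p (k + 2) n) where
  toFun z := baseElt (incl p k (z.toAdd 0), Fin.tail z.toAdd) 1
  map_one' := by
    rw [elt_eq_one]; exact ⟨Prod.ext (map_zero _) rfl, rfl⟩
  map_mul' z w := by
    rw [elt_mul, elt_inj]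
    simp [coefEnd_act, Coef.app_one]
    rfl

/-- The coefficients of the automorphisms that act trivially modulo the translations of
order `p` and on them. -/
def shearCoef : Multiplicative (Vec p (n + 1)) →* (Coef p k n)ˣ :=
  MonoidHom.toHomUnits
    { toFun := fun z => ⟨1 + incl p k (z.toAdd 0), 0, Fin.tail z.toAdd, 1⟩
      map_one' := Coef.ext (by simp) rfl rfl rfl
      map_mul' := fun z w => by
        ext : 1
        · simp [add_mul, mul_add, incl_mul]; abel
        · simp
        · simp; rfl
        · simp }

/-- The automorphisms that act trivially modulo the translations of order `p` and on them. -/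
noncomputable def shearHom : Multiplicative (Vec p (n + 1)) →* Hol (Base p (k + 2) n) where
  toFun z := baseElt 0 (shearCoef z)
  map_one' := by
    rw [elt_eq_one]; exact ⟨rfl, map_one _⟩
  map_mul' z w := by
    rw [elt_mul, elt_inj]
    simp

/-- The coefficients of the complement to the kernel over `Hol(1^n)`. -/
def sectionCoef : Hol (Elem p n) →* (Coef p k n)ˣ :=
  MonoidHom.toHomUnits <| eltLift (vecEquiv p n) (vecEnd p n)
    -- With `scale = 1` and `col = 0`, the requirements `mat⁻ᵀ = P` and `row · mat⁻¹ = l` force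
    -- these entries.
    (fun l P => ⟨1, l ᵥ* P⁻¹.valᵀ, 0, P⁻¹.valᵀ⟩) (Coef.ext rfl (by simp) rfl (by simp)) <| by
      intro x y c d
      ext : 1
      · simp
      · have : c.valᵀ * c⁻¹.valᵀ = 1 := by rw [← transpose_mul, Units.inv_mul, transpose_one]
        simp only [_root_.mul_inv_rev, Units.val_mul, transpose_mul, vecEnd_act, Coef.mul_row, map_one,
          one_smul, vecMul_vecMul, add_vecMul, ← vecMul_transpose, ← mul_assoc, this, one_mul]
        rw [add_comm]
      · simp
      · simp [transpose_mul]

theorem sectionCoef_val (l : Vec p n) (P : (Matrix (Fin n) (Fin n) (ZMod p))ˣ) :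
    (sectionCoef (k := k) (elemElt l P)).val = ⟨1, l ᵥ* P⁻¹.valᵀ, 0, P⁻¹.valᵀ⟩ :=
  eltLift_elt ..

/-- The embedding of `Hol(1^n)`. -/
noncomputable def sectionHom : Hol (Elem p n) →* Hol (Base p (k + 2) n) where
  toFun q := baseElt 0 (sectionCoef q)
  map_one' := by
    rw [elt_eq_one]; exact ⟨rfl, map_one _⟩
  map_mul' z w := by
    rw [elt_mul, elt_inj]
    simp

/-- The scalar multiplications. -/
def scalarCoef : ZMod (p ^ (k + 2)) →* Coef p k n where
  toFun a := ⟨a, 0, 0, red p k a • 1⟩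
  map_one' := Coef.ext rfl rfl rfl (by simp)
  map_mul' a b := by
    ext : 1 <;> simp [smul_smul, mul_comm]

/-- The embedding of `Hol(C_y)` in which automorphisms act as scalars. -/
noncomputable def scalarHom : Hol (Cyc (p ^ (k + 2))) →* Hol (Base p (k + 2) n) :=
  eltLift (MulEquiv.refl _) (zmodEnd _) (fun s a => baseElt (s, 0) (Units.map scalarCoef a))
    (by simp [elt_eq_one]) <| by
      intro x y c d
      rw [elt_mul, elt_inj]
      refine ⟨?_, map_mul _ _ _⟩
      ext : 1 <;> simp [scalarCoef]

@[simp] theorem scalarHom_elt (s : ZMod (p ^ (k + 2))) (a : (ZMod (p ^ (k + 2)))ˣ) :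
    scalarHom (n := n) (cycElt _ s a) = baseElt (s, 0) (Units.map scalarCoef a) :=
  eltLift_elt ..

end Holomorph

/-! ### Kernel and image of the projection, and the action of `H` -/

namespace Holomorph

open Matrix

variable {p k n : ℕ} [Fact p.Prime]

theorem shearCoef_val (z : Multiplicative (Vec p (n + 1))) :
    (shearCoef (k := k) z).val = ⟨1 + incl p k (z.toAdd 0), 0, Fin.tail z.toAdd, 1⟩ := rfl

theorem transHom_injective : Function.Injective (transHom (p := p) (k := k) (n := n)) := by
  rw [injective_iff_map_eq_one]
  intro z hz
  obtain ⟨h, -⟩ := elt_eq_one.1 hz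
  obtain ⟨h0, ht⟩ := Prod.ext_iff.1 h
  rw [← toAdd_eq_zero]
  funext i
  refine Fin.cases ?_ (fun i => congrFun ht i) i
  simpa using h0

theorem shearHom_injective : Function.Injective (shearHom (p := p) (k := k) (n := n)) := by
  rw [injective_iff_map_eq_one]
  intro z hz
  obtain ⟨-, h⟩ := elt_eq_one.1 hz
  rw [Units.ext_iff, shearCoef_val, Coef.ext_iff] at h
  rw [← toAdd_eq_zero]
  funext i
  refine Fin.cases ?_ (fun i => congrFun h.2.2.1 i) i
  simpa using h.1

theorem disjoint_trans_shear :
    Disjoint (transHom (p := p) (k := k) (n := n)).range shearHom.range := by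
  rw [Subgroup.disjoint_def]
  rintro _ ⟨z, rfl⟩ ⟨w, hw⟩
  obtain ⟨h, -⟩ := elt_inj.1 hw
  exact elt_eq_one.2 ⟨h.symm, rfl⟩

theorem commute_trans_shear (z w : Multiplicative (Vec p (n + 1))) :
    Commute (transHom (k := k) z) (shearHom w) := by
  change baseElt _ _ * baseElt _ _ = baseElt _ _ * baseElt _ _
  rw [elt_mul, elt_mul, elt_inj, shearCoef]
  refine ⟨?_, by simp⟩
  ext : 1 <;> simp [add_mul, incl_mul]

theorem ker_coords {x : ZMod (p ^ (k + 2)) × Vec p n} {c : (Coef p k n)ˣ}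
    (h : projElem (baseElt x c) = 1) : c.val.row = 0 ∧
      red p k c.val.scale • c⁻¹.val.mat = 1 := by
  rw [projElem_elt, elt_eq_one] at h
  constructor
  · have := congrArg (· ᵥ* c.val.mat) h.1
    simpa [vecMul_vecMul, mat_inv_mul] using this
  · have := congrArg (fun c => c.valᵀ) h.2
    simpa [dualMat_val] using this

theorem redT_scale {x : ZMod (p ^ (k + 2)) × Vec p n} {c : (Coef p k n)ˣ} {s : ZMod (p ^ (k + 1))}
    (h : projCyc (baseElt x c) = cycElt _ s 1) : redT p k x.1 = s ∧ redT p k c.val.scale = 1 := by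
  rw [projCyc_elt, elt_inj] at h
  exact ⟨h.1, congrArg Units.val h.2⟩

theorem mat_eq_one {c : (Coef p k n)ˣ} (h : redT p k c.val.scale = 1)
    (h' : red p k c.val.scale • c⁻¹.val.mat = 1) : c.val.mat = 1 := by
  rw [red_eq_of_redT (h.trans (map_one _).symm), map_one, one_smul] at h'
  simpa [h'] using mat_mul_inv c

/-- The projection of the holomorph of the base group to `Hol(1^n) × Hol(C_t)`. -/
noncomputable def proj : Hol (Base p (k + 2) n) →* Hol (Elem p n) × Hol (Cyc (p ^ (k + 1))) :=
  projElem.prod projCyc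

theorem proj_transHom (z : Multiplicative (Vec p (n + 1))) : proj (transHom (k := k) z) = 1 := by
  refine Prod.ext ?_ ?_
  · exact (projElem_elt _ _).trans (by simp [elt_eq_one])
  · exact (projCyc_elt _ _).trans (by simp [elt_eq_one])

theorem proj_shearHom (z : Multiplicative (Vec p (n + 1))) : proj (shearHom (k := k) z) = 1 := by
  refine Prod.ext ?_ ?_
  · refine (projElem_elt _ _).trans (elt_eq_one.2 ⟨?_, Units.ext ?_⟩)
    · simp [shearCoef_val]
    · rw [dualMat_val, ← map_inv, shearCoef_val, shearCoef_val]
      simp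
  · refine (projCyc_elt _ _).trans (elt_eq_one.2 ⟨?_, Units.ext ?_⟩)
    · simp
    · simp [shearCoef_val, scaleRedT]

theorem ker_proj : (proj (p := p) (k := k) (n := n)).ker = transHom.range ⊔ shearHom.range := by
  apply le_antisymm
  · intro g hg
    obtain ⟨x, c, rfl⟩ := exists_elt (baseEquiv p k n) (coefEnd p k n) g
    obtain ⟨h1, h2⟩ := Prod.ext_iff.1 hg
    obtain ⟨hr, hm⟩ := ker_coords h1
    obtain ⟨hx, hs⟩ := redT_scale (s := 0) (h2.trans (elt_zero_one _ _).symm)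
    obtain ⟨a, ha⟩ := exists_incl_of_redT hx
    obtain ⟨b, hb⟩ := exists_incl_of_redT (x := c.val.scale - 1) (by simp [hs])
    -- A kernel element has `row = 0`, `mat = 1`, and both `x.1` and `scale - 1` in the image of
    -- `incl`; it factors as translation times shear.
    have key : transHom (.ofAdd (Fin.cons a x.2)) * shearHom (.ofAdd (Fin.cons b c.val.col)) =
        baseElt x c := by
      change baseElt _ _ * baseElt _ _ = _
      rw [elt_mul, elt_inj, Units.ext_iff, one_mul, shearCoef_val, map_zero, add_zero]
      refine ⟨Prod.ext ha rfl, Coef.ext ?_ hr.symm rfl (mat_eq_one hs hm).symm⟩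
      simp [hb]
    change baseElt x c ∈ _
    rw [← key]
    exact mul_mem (Subgroup.mem_sup_left ⟨_, rfl⟩) (Subgroup.mem_sup_right ⟨_, rfl⟩)
  · rw [sup_le_iff]
    constructor <;> rintro _ ⟨z, rfl⟩
    · exact proj_transHom z
    · exact proj_shearHom z

theorem proj_sectionHom (q : Hol (Elem p n)) : proj (sectionHom (k := k) q) = (q, 1) := by
  obtain ⟨l, P, rfl⟩ := exists_elt (vecEquiv p n) (vecEnd p n) q
  have hinv : (sectionCoef (k := k) (elemElt l P))⁻¹.val.mat = P.valᵀ := by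
    have := mat_mul_inv (sectionCoef (k := k) (elemElt l P))
    rw [sectionCoef_val] at this
    have h2 : P.valᵀ * P⁻¹.valᵀ = 1 := by rw [← transpose_mul, Units.inv_mul, transpose_one]
    exact (left_inv_eq_right_inv h2 this).symm
  refine Prod.ext ?_ ?_
  · refine (projElem_elt _ _).trans ?_
    rw [elt_inj, Units.ext_iff, dualMat_val, hinv, sectionCoef_val, vecMul_vecMul, ← transpose_mul]
    simp
  · refine (projCyc_elt _ _).trans ?_
    rw [elt_eq_one, Units.ext_iff]
    simp [sectionCoef_val, scaleRedT]

theorem red_mul_red_inv (a : (ZMod (p ^ (k + 2)))ˣ) :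
    red p k a.val * red p k a⁻¹.val = 1 := by
  rw [← map_mul, Units.mul_inv, map_one]

theorem proj_scalarHom (s : ZMod (p ^ (k + 2))) (a : (ZMod (p ^ (k + 2)))ˣ) :
    proj (scalarHom (n := n) (cycElt _ s a)) =
      (1, cycElt _ (redT p k s) (Units.map (redT p k).toMonoidHom a)) := by
  rw [scalarHom_elt]
  refine Prod.ext ?_ ?_
  · refine (projElem_elt _ _).trans (elt_eq_one.2 ⟨?_, Units.ext ?_⟩)
    · simp [scalarCoef]
    · change red p k a.val • (red p k a⁻¹.val • (1 : Matrix (Fin n) (Fin n) (ZMod p)))ᵀ = 1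
      rw [transpose_smul, smul_smul, red_mul_red_inv, one_smul, transpose_one]
  · refine (projCyc_elt _ _).trans ?_
    rw [elt_inj, Units.ext_iff]
    simp [scalarCoef, scaleRedT]

theorem surjOn_scalarHom : Set.SurjOn (proj (p := p) (k := k) (n := n))
    ((scalarHom.range : Subgroup (Hol (Base p (k + 2) n))) : Set (Hol (Base p (k + 2) n)))
    {x | x.1 = 1} := by
  rintro ⟨q, w⟩ hq
  obtain rfl : q = 1 := hq
  obtain ⟨s, a, rfl⟩ := exists_elt (MulEquiv.refl _) (zmodEnd _) w
  obtain ⟨s, rfl⟩ := redT_surjective s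
  have : NeZero (p ^ (k + 2)) := ⟨pow_ne_zero _ (Fact.out : p.Prime).ne_zero⟩
  obtain ⟨a, rfl⟩ := ZMod.unitsMap_surjective (pow_dvd_pow p (by omega : k + 1 ≤ k + 2)) a
  exact ⟨_, ⟨_, rfl⟩, proj_scalarHom s a⟩

theorem proj_surjective : Function.Surjective (proj (p := p) (k := k) (n := n)) := by
  rintro ⟨q, w⟩
  obtain ⟨g, -, hg⟩ := surjOn_scalarHom (n := n) (a := ((1, w) : Hol (Elem p n) × _)) rfl
  refine ⟨sectionHom q * g, ?_⟩
  rw [map_mul, proj_sectionHom, hg]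
  simp

theorem commute_section_scalar (q : Hol (Elem p n)) (w : Hol (Cyc (p ^ (k + 2)))) :
    Commute (sectionHom q) (scalarHom w) := by
  obtain ⟨l, P, rfl⟩ := exists_elt (vecEquiv p n) (vecEnd p n) q
  obtain ⟨s, a, rfl⟩ := exists_elt (MulEquiv.refl _) (zmodEnd _) w
  change baseElt _ _ * _ = _ * baseElt _ _
  rw [scalarHom_elt, elt_mul, elt_mul, elt_inj, Units.ext_iff, Units.val_mul, Units.val_mul,
    sectionCoef_val, map_zero, zero_add, add_zero]
  refine ⟨Prod.ext ?_ ?_, Coef.ext ?_ ?_ ?_ ?_⟩ <;> simp [scalarCoef, vecMul_smul]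

/-- The action of `Hol(1^n)` on the factors of the kernel. -/
def kerAct (q : Hol (Elem p n)) (z : Vec p (n + 1)) : Vec p (n + 1) :=
  -- The row and matrix of `sectionCoef` do not depend on `k`, so the value `0` is an arbitrary
  -- choice.
  Fin.cons (z 0 + (sectionCoef (k := 0) q).val.row ⬝ᵥ Fin.tail z)
    ((sectionCoef (k := 0) q).val.mat *ᵥ Fin.tail z)

theorem kerAct_elt (l : Vec p n) (P : (Matrix (Fin n) (Fin n) (ZMod p))ˣ) (z : Vec p (n + 1)) :
    kerAct (elemElt l P) z =
      Fin.cons (z 0 + (l ᵥ* P⁻¹.valᵀ) ⬝ᵥ Fin.tail z) (P⁻¹.valᵀ *ᵥ Fin.tail z) := by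
  rw [kerAct, sectionCoef_val]

theorem section_mul_trans (q : Hol (Elem p n)) (z : Multiplicative (Vec p (n + 1))) :
    sectionHom (k := k) q * transHom z * (sectionHom q)⁻¹ =
      transHom (.ofAdd (kerAct q z.toAdd)) := by
  obtain ⟨l, P, rfl⟩ := exists_elt (vecEquiv p n) (vecEnd p n) q
  rw [mul_inv_eq_iff_eq_mul]
  change baseElt _ _ * baseElt _ _ = baseElt _ _ * baseElt _ _
  rw [elt_mul, elt_mul, elt_inj, kerAct_elt, coefEnd_act, sectionCoef_val]
  refine ⟨Prod.ext ?_ ?_, by simp⟩ <;> simp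

theorem section_mul_shear (q : Hol (Elem p n)) (z : Multiplicative (Vec p (n + 1))) :
    sectionHom (k := k) q * shearHom z * (sectionHom q)⁻¹ =
      shearHom (.ofAdd (kerAct q z.toAdd)) := by
  obtain ⟨l, P, rfl⟩ := exists_elt (vecEquiv p n) (vecEnd p n) q
  rw [mul_inv_eq_iff_eq_mul]
  change baseElt _ _ * baseElt _ _ = baseElt _ _ * baseElt _ _
  rw [elt_mul, elt_mul, elt_inj, kerAct_elt, Units.ext_iff, Units.val_mul, Units.val_mul,
    sectionCoef_val, shearCoef_val, shearCoef_val]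
  refine ⟨by simp, Coef.ext ?_ ?_ ?_ ?_⟩ <;> simp [add_assoc]

theorem eq_one_of_kerAct {q : Hol (Elem p n)} (h : ∀ z, kerAct q z = z) : q = 1 := by
  obtain ⟨l, P, rfl⟩ := exists_elt (vecEquiv p n) (vecEnd p n) q
  have h' (v : Vec p n) : (l ᵥ* P⁻¹.valᵀ) ⬝ᵥ v = 0 ∧ P⁻¹.valᵀ *ᵥ v = v := by
    have := h (Fin.cons 0 v)
    rw [kerAct_elt] at this
    simpa [Fin.cons_inj] using this
  have hP : P⁻¹.val = 1 := by
    rw [← transpose_inj, transpose_one]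
    exact Matrix.mulVec_injective (funext fun v => by simpa using (h' v).2)
  rw [elt_eq_one]
  refine ⟨dotProduct_eq _ _ fun v => ?_, ?_⟩
  · simpa [hP] using (h' v).1
  · rw [← inv_eq_one, Units.ext_iff, hP, Units.val_one]

end Holomorph

/-! ### Non-splitting and the structure theorem -/

namespace Holomorph

open Matrix

variable {p k n : ℕ} [Fact p.Prime]

/-- As `row = 0`, the first coordinate evolves under an affine map of `C_y` alone. Its multiplier is
`1 + ε` with `ε² = 0`, so the geometric sum of its powers is `j + choose(j, 2) ε`. -/
theorem elt_pow_coords {y : ZMod (p ^ (k + 2)) × Vec p n} {c : (Coef p k n)ˣ} {b : ZMod p}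
    (hy : red p k y.1 = 1) (hr : c.val.row = 0) (hs : c.val.scale = 1 + incl p k b) (j : ℕ) :
    ∃ z d, baseElt y c ^ j = baseElt z d ∧ d.val.row = 0 ∧ d.val.scale = 1 + j * incl p k b ∧
      z.1 = j * y.1 + incl p k (j.choose 2 * b) := by
  induction j with
  | zero => exact ⟨0, 1, by simp [elt_zero_one], rfl, by simp, by simp⟩
  | succ j ih =>
    obtain ⟨z, d, h, hr', hs', hz⟩ := ih
    refine ⟨_, _, (pow_succ (baseElt y c) j).trans ((congrArg (· * _) h).trans (elt_mul ..)),
      ?_, ?_, ?_⟩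
    · simp [hr, hr']
    · simp only [Units.val_mul, Coef.mul_scale, hr', hs', hs, zero_dotProduct, map_zero, add_zero]
      have : incl p k b * incl p k b = 0 := by simp [incl_mul]
      push_cast
      linear_combination (j : ZMod (p ^ (k + 2))) * this
    · simp only [Prod.fst_add, coefEnd_act, Coef.app_fst, hr', hs', hz, zero_dotProduct, map_zero]
      have h1 : incl p k b * y.1 = incl p k b := by simp [incl_mul, hy]
      have h2 : incl p k (j * b) = j * incl p k b := by
        rw [← nsmul_eq_mul, map_nsmul, nsmul_eq_mul]
      rw [Nat.choose_succ_succ, Nat.choose_one_right]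
      push_cast
      rw [add_mul (j : ZMod p), map_add, h2]
      linear_combination (j : ZMod (p ^ (k + 2))) * h1

theorem pow_ne_one (hp : p ≠ 2) {g : Hol (Base p (k + 2) n)} (hg : proj g = (1, cycElt _ 1 1)) :
    g ^ p ^ (k + 1) ≠ 1 := by
  have hpp : p.Prime := Fact.out
  obtain ⟨y, c, rfl⟩ := exists_elt (baseEquiv p k n) (coefEnd p k n) g
  obtain ⟨h1, h2⟩ := Prod.ext_iff.1 hg
  obtain ⟨hr, -⟩ := ker_coords h1
  obtain ⟨hx, hs⟩ := redT_scale h2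
  have hy : red p k y.1 = 1 := by
    rw [red_eq_of_redT (hx.trans (map_one _).symm), map_one]
  obtain ⟨b, hb⟩ := exists_incl_of_redT (x := c.val.scale - 1) (by simp [hs])
  obtain ⟨z, d, h, -, -, hz⟩ := elt_pow_coords hy hr (b := b) (by simp [hb]) (p ^ (k + 1))
  rw [h]
  intro h0
  rw [(elt_eq_one.1 h0).1] at hz
  -- Here oddness of `p` enters: the correction term vanishes, and the first coordinate of the power
  -- is `p ^ (k + 1) * y.1`, nonzero because `y.1` is `1` mod `p`.
  have hc : (((p ^ (k + 1)).choose 2 : ℕ) : ZMod p) = 0 := by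
    rw [ZMod.natCast_eq_zero_iff]
    refine hpp.dvd_choose_pow two_ne_zero fun h => hp ?_
    exact (Nat.prime_dvd_prime_iff_eq hpp Nat.prime_two).1 (h ▸ dvd_pow_self p (by omega))
  have hi : ((p ^ (k + 1) : ℕ) : ZMod (p ^ (k + 2))) = incl p k 1 := by
    have := incl_intCast (p := p) (k := k) 1
    push_cast at this ⊢
    rw [this, one_mul]
  rw [hc, hi, incl_mul, hy] at hz
  simp at hz
  exact one_ne_zero (incl_eq_zero.1 hz.symm)

theorem not_split_proj (hp : p ≠ 2) : ¬ ∃ C : Subgroup (Hol (Base p (k + 2) n)),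
    Subgroup.IsComplement' (transHom.range ⊔ shearHom.range) C := by
  rintro ⟨C, hC⟩
  rw [← ker_proj] at hC
  obtain ⟨⟨⟨a, ha⟩, ⟨x, hx⟩⟩, h⟩ := hC.2 (scalarHom (cycElt _ 1 1))
  have hxp : proj x = (1, cycElt _ 1 1) := by
    have h' := congrArg proj h
    rw [map_mul, MonoidHom.mem_ker.1 ha, one_mul, proj_scalarHom] at h'
    simpa using h'
  -- The image of `x` has order dividing `p ^ (k + 1)`, so this power lies in the kernel as well as
  -- in `C`.
  refine pow_ne_one hp hxp ?_
  refine Subgroup.disjoint_def.1 hC.disjoint (MonoidHom.mem_ker.2 ?_) (pow_mem hx _)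
  rw [map_pow, hxp]
  have : cycElt (p ^ (k + 1)) 1 1 = SemidirectProduct.inl (.ofAdd 1) :=
    SemidirectProduct.ext rfl (map_one _)
  rw [Prod.pow_mk, one_pow, this, ← map_pow, ← ofAdd_nsmul]
  simp

theorem isDecomposition_range (hp : p ≠ 2) : IsDecomposition p (k + 2) n transHom.range
    shearHom.range sectionHom.range scalarHom.range where
  equiv_left := ⟨(MonoidHom.ofInjective transHom_injective).symm.trans (vecEquiv p (n + 1))⟩
  equiv_right := ⟨(MonoidHom.ofInjective shearHom_injective).symm.trans (vecEquiv p (n + 1))⟩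
  disjoint := disjoint_trans_shear
  commute_left_right := by
    rintro _ ⟨z, rfl⟩ _ ⟨w, rfl⟩
    exact commute_trans_shear z w
  exists_quotient := by
    refine ⟨proj, proj_surjective, ker_proj, ⟨?_, ?_, ?_⟩, surjOn_scalarHom, ?_⟩
    · rintro _ ⟨q, rfl⟩
      change (proj _).2 = 1
      rw [proj_sectionHom]
    · rintro _ ⟨q, rfl⟩ _ ⟨q', rfl⟩ h
      rw [proj_sectionHom, proj_sectionHom] at h
      exact congrArg sectionHom (Prod.ext_iff.1 h).1
    · rintro ⟨q, w⟩ h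
      obtain rfl : w = 1 := h
      exact ⟨_, ⟨q, rfl⟩, proj_sectionHom q⟩
    · rintro _ ⟨w, rfl⟩
      obtain ⟨s, a, rfl⟩ := exists_elt (MulEquiv.refl _) (zmodEnd _) w
      change (proj _).1 = 1
      rw [proj_scalarHom]
  not_split := not_split_proj hp
  commute_lifts := by
    rintro _ ⟨z, rfl⟩ _ ⟨w, rfl⟩
    exact commute_section_scalar z w
  conj_left := by
    rintro _ ⟨q, rfl⟩ _ ⟨z, rfl⟩
    exact ⟨_, (section_mul_trans q z).symm⟩
  conj_right := by
    rintro _ ⟨q, rfl⟩ _ ⟨z, rfl⟩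
    exact ⟨_, (section_mul_shear q z).symm⟩
  faithful := by
    rintro _ ⟨q, rfl⟩ h
    rw [eq_one_of_kerAct (q := q) fun z => ?_, map_one]
    have := h _ ⟨.ofAdd z, rfl⟩
    rw [section_mul_trans] at this
    exact congrArg Multiplicative.toAdd (transHom_injective this)
  same_action := by
    refine ⟨(MonoidHom.ofInjective transHom_injective).symm.trans
      (MonoidHom.ofInjective shearHom_injective), ?_⟩
    rintro _ ⟨q, rfl⟩ ⟨_, z, rfl⟩
    have h1 (z : Multiplicative (Vec p (n + 1))) : (MonoidHom.ofInjective
        (transHom_injective (k := k))).symm ⟨transHom z, z, rfl⟩ = z :=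
      (MulEquiv.symm_apply_eq _).2 rfl
    have h2 {g : Hol (Base p (k + 2) n)} (hg) (w) (hw : g = transHom w) :
        (MonoidHom.ofInjective transHom_injective).symm ⟨g, hg⟩ = w := by
      subst hw; exact h1 w
    rw [MulEquiv.trans_apply, MulEquiv.trans_apply, h1, h2 _ _ (section_mul_trans q z)]
    exact (section_mul_shear q z).symm

end Holomorph

/-! ### Primitive roots modulo `3 ^ (k + 2)`, and the relations as equations -/

namespace Holomorph

open Matrix

section Units

variable {k j : ℕ}

theorem sixteen_pow (k : ℕ) : (16 : ZMod (3 ^ (k + 2))) ^ 3 ^ k = 1 - 3 ^ (k + 1) := by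
  have h : ∃ q : ℤ, (16 : ℤ) ^ 3 ^ k = 1 - 3 ^ (k + 1) + 3 ^ (k + 2) * q := by
    induction k with
    | zero => exact ⟨2, by norm_num⟩
    | succ k ih =>
      obtain ⟨q, hq⟩ := ih
      -- From expanding `(1 + 3 ^ (k + 1) * (3 * q - 1)) ^ 3`.
      refine ⟨q + 3 ^ k * (3 * q - 1) ^ 2 + 3 ^ k * 3 ^ k * (3 * q - 1) ^ 3, ?_⟩
      rw [pow_succ 3 k, pow_mul, hq]
      ring
  obtain ⟨q, hq⟩ := h
  have h3 : (3 : ZMod (3 ^ (k + 2))) ^ (k + 2) = 0 := by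
    exact_mod_cast ZMod.natCast_self (3 ^ (k + 2))
  have := congrArg (Int.cast : ℤ → ZMod (3 ^ (k + 2))) hq
  push_cast at this
  rw [this, h3, zero_mul, add_zero]

theorem incl_one (k : ℕ) : incl 3 k 1 = 3 ^ (k + 1) := by
  simpa using incl_intCast (p := 3) (k := k) 1

theorem totient_three_pow (k : ℕ) : (3 ^ (k + 2)).totient = 2 * 3 ^ (k + 1) := by
  rw [Nat.totient_prime_pow Nat.prime_three (by omega), mul_comm]
  rfl

/-- Euler's theorem bounds the order. Half this exponent is odd, giving `-1` mod `3`; a third of it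
is `2 * 3 ^ k`, which divides `j`, while `u ^ j ≠ 1`. -/
theorem orderOf_eq (u : (ZMod (3 ^ (k + 2)))ˣ) (hu : red 3 k u = -1) (hj : 2 * 3 ^ k ∣ j)
    (huj : (u : ZMod (3 ^ (k + 2))) ^ j = 1 - incl 3 k 1) : orderOf u = 2 * 3 ^ (k + 1) := by
  refine orderOf_eq_of_pow_and_pow_div_prime (by positivity) ?_ fun q hq hqd h => ?_
  · rw [← totient_three_pow, ZMod.pow_totient]
  · rcases (hq.dvd_mul).1 hqd with hq2 | hq3
    · obtain rfl := (Nat.prime_dvd_prime_iff_eq hq Nat.prime_two).1 hq2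
      rw [Nat.mul_div_cancel_left _ two_pos] at h
      have := congrArg (fun u : (ZMod (3 ^ (k + 2)))ˣ => red 3 k u) h
      simp only [Units.val_pow_eq_pow_val, map_pow, hu, Units.val_one, map_one] at this
      rw [Odd.neg_one_pow (Odd.pow (by decide))] at this
      exact absurd this (by decide)
    · obtain rfl := (Nat.prime_dvd_prime_iff_eq hq Nat.prime_three).1 (hq.dvd_of_dvd_pow hq3)
      rw [show 2 * 3 ^ (k + 1) / 3 = 2 * 3 ^ k by omega] at h
      obtain ⟨l, rfl⟩ := hj
      rw [← Units.val_pow_eq_pow_val, pow_mul, h, one_pow, Units.val_one] at huj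
      have : incl 3 k 1 = 0 := by linear_combination huj
      rw [incl_eq_zero] at this
      exact absurd this (by decide)

theorem mem_zpowers_of_orderOf {u : (ZMod (3 ^ (k + 2)))ˣ} (hu : orderOf u = 2 * 3 ^ (k + 1))
    (v : (ZMod (3 ^ (k + 2)))ˣ) : v ∈ Subgroup.zpowers u := by
  have : Subgroup.zpowers u = ⊤ := by
    apply Subgroup.eq_top_of_card_eq
    rw [Nat.card_zpowers, hu, Nat.card_eq_fintype_card, ZMod.card_units_eq_totient,
      totient_three_pow]
  rw [this]
  trivial

end Units

section Relations

/-- The defining relations of the presentation for a family of elements of a group. -/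
structure GenRelations {G : Type*} [Group G] (m : ℕ) (i : ℤ) (j : ℕ) (g : Gen → G) : Prop where
  a_pow : g .a ^ 3 = 1
  b_pow : g .b ^ 3 = 1
  c_pow : g .c ^ 3 = 1
  d_pow : g .d ^ 3 = 1
  a_b : g .a * g .b = g .b * g .a
  a_c : g .a * g .c = g .c * g .a
  a_d : g .a * g .d = g .d * g .a
  b_c : g .b * g .c = g .c * g .b
  b_d : g .b * g .d = g .d * g .b
  c_d : g .c * g .d = g .d * g .c
  e1_pow : g .e1 ^ 3 = 1
  f1_pow : g .f1 ^ 2 = 1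
  e1_f1 : g .e1 * g .f1 = g .f1 * (g .e1)⁻¹
  a_e1 : g .a * g .e1 = g .e1 * (g .b * g .a)
  b_e1 : g .b * g .e1 = g .e1 * g .b
  a_f1 : g .a * g .f1 = g .f1 * (g .a)⁻¹
  b_f1 : g .b * g .f1 = g .f1 * g .b
  c_e1 : g .c * g .e1 = g .e1 * (g .d * g .c)
  d_e1 : g .d * g .e1 = g .e1 * g .d
  c_f1 : g .c * g .f1 = g .f1 * (g .c)⁻¹
  d_f1 : g .d * g .f1 = g .f1 * g .d
  e_pow : g .e ^ 3 ^ m = 1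
  f_pow : g .f ^ (2 * 3 ^ (m - 1)) = 1
  e_f : g .e * g .f = g .f * (g .e ^ i)⁻¹
  e_pow_b : g .e ^ 3 ^ (m - 1) = (g .b)⁻¹
  d_eq : g .d = g .f ^ j
  e_e1 : g .e * g .e1 = g .e1 * g .e
  e_f1 : g .e * g .f1 = g .f1 * g .e
  f_e1 : g .f * g .e1 = g .e1 * g .f
  f_f1 : g .f * g .f1 = g .f1 * g .f
  a_e : g .a * g .e = g .e * g .a
  c_e : g .c * g .e = g .e * (g .c * (g .a)⁻¹)
  a_f : g .a * g .f = g .f * (g .a)⁻¹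
  c_f : g .c * g .f = g .f * g .c
  b_e : g .b * g .e = g .e * g .b
  d_e : g .d * g .e = g .e * (g .d * (g .b)⁻¹)
  b_f : g .b * g .f = g .f * (g .b)⁻¹
  d_f : g .d * g .f = g .f * g .d

variable {G H : Type} [Group G] [Group H]

theorem map_cm (φ : G →* H) (x y : G) : φ (cm x y) = cm (φ x) (φ y) := by simp [cm]

theorem map_cj (φ : G →* H) (x y : G) : φ (cj x y) = cj (φ x) (φ y) := by simp [cj]

theorem cm_eq_one {x y : G} : cm x y = 1 ↔ x * y = y * x := by
  rw [cm, mul_assoc, ← _root_.mul_inv_rev, inv_mul_eq_one, eq_comm]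

theorem cj_eq_iff {x y z : G} : cj x y = z ↔ x * y = y * z := by
  rw [cj, mul_assoc, inv_mul_eq_iff_eq_mul]

theorem genRelations_iff {m : ℕ} {i : ℤ} {j : ℕ} {g : Gen → G} :
    (∀ r ∈ relators m i j, FreeGroup.lift g r = 1) ↔ GenRelations m i j g := by
  simp only [relators, Set.union_insert, Set.union_singleton, Set.mem_insert_iff,
    Set.mem_singleton_iff, or_imp, forall_and, forall_eq, map_mul, map_inv, map_cm, map_cj,
    map_pow, map_zpow, FreeGroup.lift_apply_of, cm_eq_one, cj_eq_iff, mul_assoc,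
    _root_.mul_inv_rev, inv_inv, _root_.inv_inj, mul_eq_one_iff_eq_inv]
  constructor
  · rintro ⟨h1, h2, h3, h4, h5, h6, h7, h8, h9, h10, h11, h12, h13, h14, h15, h16, h17, h18, h19,
      h20, h21, h22, h23, h24, h25, h26, h27, h28, h29, h30, h31, h32, h33, h34, h35, h36, h37,
      h38⟩
    constructor <;> assumption
  · intro h
    cases h
    refine ⟨?_, ?_, ?_, ?_, ?_, ?_, ?_, ?_, ?_, ?_, ?_, ?_, ?_, ?_, ?_, ?_, ?_, ?_, ?_, ?_, ?_, ?_,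
      ?_, ?_, ?_, ?_, ?_, ?_, ?_, ?_, ?_, ?_, ?_, ?_, ?_, ?_, ?_, ?_⟩ <;> assumption

end Relations

end Holomorph

/-! ### The generators in the holomorph of `C_(3^m) × C_3` -/

namespace Holomorph

open Matrix

section EltPow

variable {M X : Type*} {G : Type} [Monoid M] [AddCommGroup X] [Group G]
  (e : Multiplicative X ≃* G) (r : EndParam M X)

theorem elt_one_zpow (x : X) (i : ℤ) : elt e r x 1 ^ i = elt e r (i • x) 1 := by
  have h (x : X) : elt e r x 1 = SemidirectProduct.inl (e (.ofAdd x)) :=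
    SemidirectProduct.ext rfl (map_one _)
  rw [h, h, ← map_zpow, ← map_zpow, ofAdd_zsmul]

theorem elt_zero_zpow (c : Mˣ) (i : ℤ) : elt e r 0 c ^ i = elt e r 0 (c ^ i) := by
  have h (c : Mˣ) : elt e r 0 c = SemidirectProduct.inr (autEquiv e r c) :=
    SemidirectProduct.ext (map_one _) rfl
  rw [h, h, ← map_zpow, ← map_zpow]

theorem elt_one_pow (x : X) (i : ℕ) : elt e r x 1 ^ i = elt e r (i • x) 1 := by
  simpa using elt_one_zpow e r x i

theorem elt_zero_pow (c : Mˣ) (i : ℕ) : elt e r 0 c ^ i = elt e r 0 (c ^ i) := by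
  simpa using elt_zero_zpow e r c i

theorem elt_one_mul_elt_zero (x : X) (c : Mˣ) : elt e r x 1 * elt e r 0 c = elt e r x c := by
  rw [elt_mul, elt_inj]
  simp

end EltPow

variable {k : ℕ}

/-- The generators of the holomorph of `C_(3^(k+2)) × C_3`. -/
noncomputable def genElt (u : (ZMod (3 ^ (k + 2)))ˣ) : Gen → Hol (Base 3 (k + 2) 1)
  -- By `shear_mul_scalar`, conjugating a shear by `e` multiplies it by the translation with the
  -- same parameter. The relations ask for the factors `a⁻¹` and `b⁻¹`, whence the signs of `a` and
  -- `b`.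
  | .a => transHom (.ofAdd ![0, -1])
  | .b => transHom (.ofAdd ![-1, 0])
  | .c => shearHom (.ofAdd ![0, 1])
  | .d => shearHom (.ofAdd ![1, 0])
  | .e => scalarHom (cycElt _ 1 1)
  -- The inverse appears because `e^f = f⁻¹ e f`: with this choice `e^f` is translation by `u`.
  | .f => scalarHom (cycElt _ 0 u⁻¹)
  | .e1 => sectionHom (elemElt (fun _ => -1) 1)
  | .f1 => sectionHom (elemElt 0 (-1))

theorem pow_three_eq_one {n : ℕ} (z : Multiplicative (Vec 3 n)) : z ^ 3 = 1 := by
  rw [← toAdd_eq_zero, toAdd_pow]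
  funext i
  rw [Pi.smul_apply, Pi.zero_apply]
  generalize z.toAdd i = x
  revert x
  decide

theorem trans_mul_section {p k n : ℕ} [Fact p.Prime] {q : Hol (Elem p n)} {z w : Vec p (n + 1)}
    (h : kerAct q w = z) : transHom (k := k) (.ofAdd z) * sectionHom q =
      sectionHom q * transHom (.ofAdd w) := by
  rw [mul_inv_eq_iff_eq_mul.1 (section_mul_trans q (.ofAdd w)), toAdd_ofAdd, h]

theorem shear_mul_section {p k n : ℕ} [Fact p.Prime] {q : Hol (Elem p n)} {z w : Vec p (n + 1)}
    (h : kerAct q w = z) : shearHom (k := k) (.ofAdd z) * sectionHom q =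
      sectionHom q * shearHom (.ofAdd w) := by
  rw [mul_inv_eq_iff_eq_mul.1 (section_mul_shear q (.ofAdd w)), toAdd_ofAdd, h]

theorem commute_trans_scalar {p k n : ℕ} [Fact p.Prime] (z : Multiplicative (Vec p (n + 1)))
    (s : ZMod (p ^ (k + 2))) : Commute (transHom z) (scalarHom (cycElt _ s 1)) := by
  rw [scalarHom_elt]
  change baseElt _ _ * baseElt _ _ = baseElt _ _ * baseElt _ _
  rw [elt_mul, elt_mul, elt_inj]
  simp [Coef.app_one, add_comm]

theorem trans_mul_scalar {p k n : ℕ} [Fact p.Prime] (z : Multiplicative (Vec p (n + 1)))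
    {a : (ZMod (p ^ (k + 2)))ˣ} (ha : red p k a = -1) :
    transHom z * scalarHom (cycElt _ 0 a) = scalarHom (cycElt _ 0 a) * (transHom z)⁻¹ := by
  rw [scalarHom_elt, ← map_inv]
  change baseElt _ _ * baseElt _ _ = baseElt _ _ * baseElt _ _
  rw [elt_mul, elt_mul, elt_inj]
  refine ⟨Prod.ext ?_ ?_, by simp⟩
  · simp [scalarCoef, mul_comm a.val, incl_mul, ha]
  · funext i
    simp [scalarCoef, ha, neg_mulVec, Fin.tail_def]

theorem shear_mul_scalar {p k n : ℕ} [Fact p.Prime] (z : Multiplicative (Vec p (n + 1))) :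
    shearHom z * scalarHom (cycElt (p ^ (k + 2)) 1 1) =
      scalarHom (cycElt _ 1 1) * (shearHom z * transHom z) := by
  rw [scalarHom_elt]
  change baseElt _ _ * baseElt _ _ = baseElt _ _ * (baseElt _ _ * baseElt _ _)
  rw [elt_mul, elt_mul, elt_mul, elt_inj]
  refine ⟨Prod.ext ?_ ?_, by simp⟩ <;> simp [shearCoef_val, add_mul, incl_mul]

theorem commute_shear_scalar {p k n : ℕ} [Fact p.Prime] (z : Multiplicative (Vec p (n + 1)))
    (a : (ZMod (p ^ (k + 2)))ˣ) : Commute (shearHom z) (scalarHom (cycElt _ 0 a)) := by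
  rw [scalarHom_elt]
  change baseElt _ _ * baseElt _ _ = baseElt _ _ * baseElt _ _
  rw [elt_mul, elt_mul, elt_inj, Units.ext_iff, Units.val_mul, Units.val_mul, shearCoef_val]
  refine ⟨Prod.ext ?_ ?_, Coef.ext ?_ ?_ ?_ ?_⟩ <;> simp [scalarCoef, mul_comm, smul_mulVec]

theorem kerAct_transvection (x y : ZMod 3) :
    kerAct (elemElt (fun _ : Fin 1 => (-1 : ZMod 3)) 1) ![x, y] = ![x - y, y] := by
  rw [kerAct_elt]
  ext i
  fin_cases i <;> simp [Fin.tail, dotProduct, sub_eq_add_neg]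

theorem kerAct_neg (x y : ZMod 3) :
    kerAct (elemElt (0 : Vec 3 1) (-1)) ![x, y] = ![x, -y] := by
  rw [kerAct_elt]
  ext i
  fin_cases i <;> simp [Fin.tail, dotProduct, neg_mulVec]

theorem red_inv_eq {p k : ℕ} [Fact p.Prime] {u : (ZMod (p ^ (k + 2)))ˣ} (hu : red p k u = -1) :
    red p k u⁻¹.val = -1 := by
  have := red_mul_red_inv u
  rw [hu] at this
  linear_combination -this

theorem genRelations_genElt {u : (ZMod (3 ^ (k + 2)))ˣ} {i : ℤ} {j : ℕ}
    (hi : (u : ZMod (3 ^ (k + 2))) = -i) (hu : red 3 k u = -1)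
    (hord : orderOf u = 2 * 3 ^ (k + 1))
    (huj : (u : ZMod (3 ^ (k + 2))) ^ j = 1 - incl 3 k 1) :
    GenRelations (k + 2) i j (genElt u) where
  a_pow := by simp only [genElt, ← map_pow, pow_three_eq_one, map_one]
  b_pow := by simp only [genElt, ← map_pow, pow_three_eq_one, map_one]
  c_pow := by simp only [genElt, ← map_pow, pow_three_eq_one, map_one]
  d_pow := by simp only [genElt, ← map_pow, pow_three_eq_one, map_one]
  a_b := ((Commute.all _ _).map transHom).eq
  a_c := commute_trans_shear _ _
  a_d := commute_trans_shear _ _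
  b_c := commute_trans_shear _ _
  b_d := commute_trans_shear _ _
  c_d := ((Commute.all _ _).map shearHom).eq
  e1_pow := by
    simp only [genElt, ← map_pow, elt_one_pow]
    rw [← map_one sectionHom]
    congr 1
    rw [elt_eq_one]
    exact ⟨by ext; simp; decide, rfl⟩
  f1_pow := by
    simp only [genElt, ← map_pow, elt_zero_pow]
    rw [neg_sq, one_pow, elt_zero_one, map_one]
  e1_f1 := by
    simp only [genElt, ← map_mul, ← map_inv]
    congr 1
    rw [← _root_.zpow_neg_one, elt_one_zpow, elt_mul, elt_mul, elt_inj]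
    refine ⟨?_, by simp⟩
    ext
    simp [neg_mulVec]
  a_e1 := by
    simp only [genElt, ← map_mul, ← ofAdd_add]
    exact trans_mul_section (by simp [kerAct_transvection])
  b_e1 := trans_mul_section (by simp [kerAct_transvection])
  a_f1 := by
    simp only [genElt, ← map_inv, ← ofAdd_neg]
    exact trans_mul_section (by simp [kerAct_neg])
  b_f1 := trans_mul_section (by simp [kerAct_neg])
  c_e1 := by
    simp only [genElt, ← map_mul, ← ofAdd_add]
    exact shear_mul_section (by simp [kerAct_transvection])
  d_e1 := shear_mul_section (by simp [kerAct_transvection])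
  c_f1 := by
    simp only [genElt, ← map_inv, ← ofAdd_neg]
    exact shear_mul_section (by simp [kerAct_neg])
  d_f1 := shear_mul_section (by simp [kerAct_neg])
  e_pow := by
    simp only [genElt, ← map_pow, elt_one_pow]
    rw [nsmul_one, ZMod.natCast_self, elt_zero_one, map_one]
  f_pow := by
    simp only [genElt, ← map_pow, elt_zero_pow]
    rw [inv_pow, show k + 2 - 1 = k + 1 from rfl, ← hord, pow_orderOf_eq_one, inv_one,
      elt_zero_one, map_one]
  e_f := by
    simp only [genElt, ← map_mul, ← map_inv, ← map_zpow]
    congr 1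
    rw [elt_one_zpow, ← _root_.zpow_neg_one (cycElt _ _ 1), elt_one_zpow, elt_mul, elt_mul, elt_inj]
    have : (i : ZMod (3 ^ (k + 2))) = -u := by rw [hi, neg_neg]
    simp [this]
  e_pow_b := by
    have h : genElt u .e ^ 3 ^ (k + 2 - 1) = baseElt (3 ^ (k + 1), 0) 1 := by
      simp only [genElt, ← map_pow, elt_one_pow]
      rw [scalarHom_elt, map_one, nsmul_one]
      simp
    rw [h]
    simp only [genElt, ← map_inv, ← ofAdd_neg]
    refine elt_inj.2 ⟨?_, rfl⟩
    ext i
    · simp [incl_one]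
    · fin_cases i; simp [Fin.tail]
  d_eq := by
    have h : genElt u .f ^ j = baseElt 0 (Units.map scalarCoef (u⁻¹ ^ j)) := by
      simp only [genElt, ← map_pow, elt_zero_pow]
      rw [scalarHom_elt]
      rfl
    -- `1 - ε` and `1 + ε` are inverse to each other because `ε² = 0`.
    have huj' : (u⁻¹ ^ j).val = 1 + incl 3 k 1 := by
      have h1 : (u⁻¹ ^ j).val * u.val ^ j = 1 := by
        rw [← Units.val_pow_eq_pow_val, ← Units.val_mul, inv_pow, inv_mul_cancel, Units.val_one]
      have h2 : incl 3 k 1 * incl 3 k 1 = 0 := by simp [incl_mul]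
      rw [huj] at h1
      linear_combination (1 + incl 3 k 1) * h1 + (u⁻¹ ^ j).val * h2
    rw [h]
    refine elt_inj.2 ⟨rfl, Units.ext (Coef.ext ?_ rfl ?_ ?_)⟩
    · exact huj'.symm
    · ext i
      fin_cases i
      rfl
    · change 1 = red 3 k (u⁻¹ ^ j).val • 1
      rw [huj', map_add, red_incl, map_one, add_zero, one_smul]
  e_e1 := (commute_section_scalar _ _).symm
  e_f1 := (commute_section_scalar _ _).symm
  f_e1 := (commute_section_scalar _ _).symm
  f_f1 := (commute_section_scalar _ _).symm
  a_e := commute_trans_scalar _ _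
  c_e := by
    simp only [genElt, ← map_inv, ← ofAdd_neg]
    simpa using shear_mul_scalar (p := 3) (k := k) (n := 1) (.ofAdd ![0, 1])
  a_f := trans_mul_scalar _ (red_inv_eq hu)
  c_f := commute_shear_scalar _ _
  b_e := commute_trans_scalar _ _
  d_e := by
    simp only [genElt, ← map_inv, ← ofAdd_neg]
    simpa using shear_mul_scalar (p := 3) (k := k) (n := 1) (.ofAdd ![1, 0])
  b_f := trans_mul_scalar _ (red_inv_eq hu)
  d_f := commute_shear_scalar _ _

end Holomorph

/-! ### Normal forms from the relations -/

namespace Holomorph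

section NormalForm

variable {G : Type} [Group G] {m j : ℕ} {i : ℤ} {g : Gen → G}

/-- The products `a^w b^x c^y d^z`. -/
def kerWord (g : Gen → G) (w x y z : ℤ) : G :=
  g .a ^ w * (g .b ^ x * (g .c ^ y * g .d ^ z))

namespace GenRelations

variable (h : GenRelations m i j g)
include h

theorem kerWord_mul (w x y z w' x' y' z' : ℤ) :
    kerWord g w x y z * kerWord g w' x' y' z' = kerWord g (w + w') (x + x') (y + y') (z + z') := by
  have ba : Commute (g .b) (g .a) := h.a_b.symm
  have ca : Commute (g .c) (g .a) := h.a_c.symm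
  have da : Commute (g .d) (g .a) := h.a_d.symm
  have cb : Commute (g .c) (g .b) := h.b_c.symm
  have db : Commute (g .d) (g .b) := h.b_d.symm
  have dc : Commute (g .d) (g .c) := h.c_d.symm
  unfold kerWord
  rw [Commute.mul_mul_mul_comm, Commute.mul_mul_mul_comm (b := g .c ^ y * _),
    Commute.mul_mul_mul_comm (b := g .d ^ z), zpow_add, zpow_add, zpow_add, zpow_add]
  · exact dc.zpow_zpow _ _
  · exact (cb.zpow_zpow _ _).mul_left (db.zpow_zpow _ _)
  · exact (ba.zpow_zpow _ _).mul_left ((ca.zpow_zpow _ _).mul_left (da.zpow_zpow _ _))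

/-- The subgroup generated by `a, b, c, d`. -/
def kerSubgroup : Subgroup G where
  carrier := {n | ∃ w x y z, kerWord g w x y z = n}
  one_mem' := ⟨0, 0, 0, 0, by simp [kerWord]⟩
  mul_mem' := by
    rintro _ _ ⟨w, x, y, z, rfl⟩ ⟨w', x', y', z', rfl⟩
    exact ⟨_, _, _, _, (h.kerWord_mul ..).symm⟩
  inv_mem' := by
    rintro _ ⟨w, x, y, z, rfl⟩
    refine ⟨-w, -x, -y, -z, ?_⟩
    rw [eq_inv_iff_mul_eq_one, h.kerWord_mul]
    simp [kerWord]

theorem a_mem : g .a ∈ h.kerSubgroup := ⟨1, 0, 0, 0, by simp [kerWord]⟩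
theorem b_mem : g .b ∈ h.kerSubgroup := ⟨0, 1, 0, 0, by simp [kerWord]⟩
theorem c_mem : g .c ∈ h.kerSubgroup := ⟨0, 0, 1, 0, by simp [kerWord]⟩
theorem d_mem : g .d ∈ h.kerSubgroup := ⟨0, 0, 0, 1, by simp [kerWord]⟩

/-- A relation `y x = x y'` says `x⁻¹ y = y' x⁻¹`, so `x⁻¹` can be moved rightwards past kernel
words. -/
theorem conj_mem {x a' b' c' d' : G} (ha : g .a * x = x * a') (hb : g .b * x = x * b')
    (hc : g .c * x = x * c') (hd : g .d * x = x * d') (ha' : a' ∈ h.kerSubgroup)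
    (hb' : b' ∈ h.kerSubgroup) (hc' : c' ∈ h.kerSubgroup) (hd' : d' ∈ h.kerSubgroup) {n : G}
    (hn : n ∈ h.kerSubgroup) : ∃ n' ∈ h.kerSubgroup, x⁻¹ * n = n' * x⁻¹ := by
  obtain ⟨q, r, s, t, rfl⟩ := hn
  have hs {y y' : G} (hy : y * x = x * y') : SemiconjBy x⁻¹ y y' := by
    rw [SemiconjBy, inv_mul_eq_iff_eq_mul, ← mul_assoc, eq_mul_inv_iff_mul_eq, hy]
  exact ⟨_, mul_mem (zpow_mem ha' q) (mul_mem (zpow_mem hb' r) (mul_mem (zpow_mem hc' s)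
    (zpow_mem hd' t))), ((hs ha).zpow_right q).mul_right (((hs hb).zpow_right r).mul_right
    (((hs hc).zpow_right s).mul_right ((hs hd).zpow_right t)))⟩

omit h in
theorem inv_mul_zpow (x : G) (r : ℤ) : x⁻¹ * x ^ r = x ^ (r - 1) := by
  rw [sub_eq_add_neg, add_comm, zpow_add, zpow_neg_one]

omit h in
theorem inv_mul_word {x n n' : G} (u v : G) (hx : x⁻¹ * n = n' * x⁻¹) :
    x⁻¹ * (n * u * v) = n' * (x⁻¹ * u) * v := by
  simp only [← mul_assoc, hx]

/-- The elements in normal form. -/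
def normalForms : Set G :=
  {v | ∃ n ∈ h.kerSubgroup, ∃ r s x y : ℤ,
    n * (g .e1 ^ r * g .f1 ^ s) * (g .e ^ x * g .f ^ y) = v}

theorem ker_mul_mem {n v : G} (hn : n ∈ h.kerSubgroup) (hv : v ∈ h.normalForms) :
    n * v ∈ h.normalForms := by
  obtain ⟨n', hn', r, s, x, y, rfl⟩ := hv
  exact ⟨n * n', mul_mem hn hn', r, s, x, y, by simp only [mul_assoc]⟩

theorem e1_inv_mul_mem {v : G} (hv : v ∈ h.normalForms) : (g .e1)⁻¹ * v ∈ h.normalForms := by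
  obtain ⟨n, hn, r, s, x, y, rfl⟩ := hv
  obtain ⟨n', hn', hnn⟩ := h.conj_mem h.a_e1 h.b_e1 h.c_e1 h.d_e1
    (mul_mem h.b_mem h.a_mem) h.b_mem (mul_mem h.d_mem h.c_mem) h.d_mem hn
  refine ⟨n', hn', r - 1, s, x, y, ?_⟩
  rw [inv_mul_word _ _ hnn, ← inv_mul_zpow]
  simp only [mul_assoc]

theorem f1_inv_mul_mem {v : G} (hv : v ∈ h.normalForms) : (g .f1)⁻¹ * v ∈ h.normalForms := by
  obtain ⟨n, hn, r, s, x, y, rfl⟩ := hv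
  obtain ⟨n', hn', hnn⟩ := h.conj_mem h.a_f1 h.b_f1 h.c_f1 h.d_f1
    (inv_mem h.a_mem) h.b_mem (inv_mem h.c_mem) h.d_mem hn
  have hs : SemiconjBy (g .f1)⁻¹ (g .e1) (g .e1)⁻¹ := by
    rw [SemiconjBy, inv_mul_eq_iff_eq_mul, ← mul_assoc, eq_mul_inv_iff_mul_eq, h.e1_f1]
  have hs' := (hs.zpow_right r).eq
  refine ⟨n', hn', -r, s - 1, x, y, ?_⟩
  rw [inv_mul_word _ _ hnn, ← mul_assoc _ (g .e1 ^ r), hs', inv_zpow',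
    mul_assoc _ _ (g .f1 ^ s), inv_mul_zpow]

theorem e_inv_mul_mem {v : G} (hv : v ∈ h.normalForms) : (g .e)⁻¹ * v ∈ h.normalForms := by
  obtain ⟨n, hn, r, s, x, y, rfl⟩ := hv
  obtain ⟨n', hn', hnn⟩ := h.conj_mem h.a_e h.b_e h.c_e h.d_e
    h.a_mem h.b_mem (mul_mem h.c_mem (inv_mem h.a_mem)) (mul_mem h.d_mem (inv_mem h.b_mem)) hn
  have h1 : Commute (g .e)⁻¹ (g .e1 ^ r * g .f1 ^ s) :=
    Commute.inv_left (.mul_right (.zpow_right h.e_e1 _) (.zpow_right h.e_f1 _))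
  refine ⟨n', hn', r, s, x - 1, y, ?_⟩
  rw [inv_mul_word _ _ hnn, h1.eq, ← inv_mul_zpow]
  simp only [mul_assoc]

theorem f_inv_mul_mem {v : G} (hv : v ∈ h.normalForms) : (g .f)⁻¹ * v ∈ h.normalForms := by
  obtain ⟨n, hn, r, s, x, y, rfl⟩ := hv
  obtain ⟨n', hn', hnn⟩ := h.conj_mem h.a_f h.b_f h.c_f h.d_f
    (inv_mem h.a_mem) (inv_mem h.b_mem) h.c_mem h.d_mem hn
  have h1 : Commute (g .f)⁻¹ (g .e1 ^ r * g .f1 ^ s) :=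
    Commute.inv_left (.mul_right (.zpow_right h.f_e1 _) (.zpow_right h.f_f1 _))
  have hs : SemiconjBy (g .f)⁻¹ (g .e) (g .e ^ i)⁻¹ := by
    rw [SemiconjBy, inv_mul_eq_iff_eq_mul, ← mul_assoc, eq_mul_inv_iff_mul_eq, h.e_f]
  have hs' := (hs.zpow_right x).eq
  refine ⟨n', hn', r, s, -i * x, y - 1, ?_⟩
  rw [inv_mul_word _ _ hnn, h1.eq, zpow_mul, zpow_neg, ← inv_mul_zpow,
    ← mul_assoc _ _ (g .f ^ y), ← hs']
  simp only [mul_assoc]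

/-- The relations move only inverses of generators to the right. Finite order turns `x` itself into
a power of `x⁻¹`. -/
theorem mul_mem_of_pow {x : G} {N : ℕ} (hN : 0 < N) (hx : x ^ N = 1)
    (hi : ∀ v ∈ h.normalForms, x⁻¹ * v ∈ h.normalForms) :
    ∀ v ∈ h.normalForms, x * v ∈ h.normalForms := by
  have hp (l : ℕ) : ∀ v ∈ h.normalForms, x⁻¹ ^ l * v ∈ h.normalForms := by
    induction l with
    | zero => simp
    | succ l ih => intro v hv; rw [pow_succ, mul_assoc]; exact ih _ (hi v hv)
  intro v hv
  have : x = x⁻¹ ^ (N - 1) := by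
    rw [inv_pow, eq_inv_iff_mul_eq_one, ← pow_succ', Nat.sub_add_cancel hN, hx]
  rw [this]
  exact hp _ v hv

theorem gen_mul_mem (t : Gen) :
    (∀ v ∈ h.normalForms, g t * v ∈ h.normalForms) ∧
      ∀ v ∈ h.normalForms, (g t)⁻¹ * v ∈ h.normalForms := by
  have hN (N) {x : G} (hN : 0 < N) (hx : x ^ N = 1)
      (hi : ∀ v ∈ h.normalForms, x⁻¹ * v ∈ h.normalForms) :
      (∀ v ∈ h.normalForms, x * v ∈ h.normalForms) ∧
        ∀ v ∈ h.normalForms, x⁻¹ * v ∈ h.normalForms := ⟨h.mul_mem_of_pow hN hx hi, hi⟩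
  have hk {x : G} (hx : x ∈ h.kerSubgroup) : (∀ v ∈ h.normalForms, x * v ∈ h.normalForms) ∧
      ∀ v ∈ h.normalForms, x⁻¹ * v ∈ h.normalForms :=
    ⟨fun _ => h.ker_mul_mem hx, fun _ => h.ker_mul_mem (inv_mem hx)⟩
  cases t with
  | a => exact hk h.a_mem
  | b => exact hk h.b_mem
  | c => exact hk h.c_mem
  | d => exact hk h.d_mem
  | e => exact hN _ (by positivity) h.e_pow fun _ => h.e_inv_mul_mem
  | f => exact hN _ (by positivity) h.f_pow fun _ => h.f_inv_mul_mem
  | e1 => exact hN _ (by positivity) h.e1_pow fun _ => h.e1_inv_mul_mem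
  | f1 => exact hN _ (by positivity) h.f1_pow fun _ => h.f1_inv_mul_mem

theorem lift_mem (w : FreeGroup Gen) : FreeGroup.lift g w ∈ h.normalForms := by
  have key : ∀ v ∈ h.normalForms, FreeGroup.lift g w * v ∈ h.normalForms := by
    induction w using FreeGroup.induction_on with
    | C1 => simp
    | of t => simpa using (h.gen_mul_mem t).1
    | inv_of t _ => simpa using (h.gen_mul_mem t).2
    | mul x y hx hy =>
      intro v hv
      rw [map_mul, mul_assoc]
      exact hx _ (hy _ hv)
  simpa using key 1 ⟨1, one_mem _, 0, 0, 0, 0, by simp⟩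

end GenRelations

end NormalForm

end Holomorph

/-! ### Generation, faithfulness and the two presentations -/

namespace Holomorph

variable {k : ℕ}

section Generation

variable (u : (ZMod (3 ^ (k + 2)))ˣ)

theorem closure_map_pair {G H : Type*} [Group G] [Group H] (φ : G →* H) {x y : G}
    (h : Subgroup.closure {x, y} = ⊤) : Subgroup.closure {φ x, φ y} = φ.range := by
  rw [← Set.image_pair, ← MonoidHom.map_closure, h, MonoidHom.range_eq_map]

theorem closure_vec_two : Subgroup.closure
    {Multiplicative.ofAdd (![0, 1] : Vec 3 2), .ofAdd ![1, 0]} = ⊤ := by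
  rw [eq_top_iff]
  rintro z -
  rw [Subgroup.mem_closure_pair]
  refine ⟨(z.toAdd 1).val, (z.toAdd 0).val, ?_⟩
  rw [← ofAdd_zsmul, ← ofAdd_zsmul, ← ofAdd_add]
  change Multiplicative.ofAdd _ = .ofAdd z.toAdd
  congr 1
  ext i
  fin_cases i <;> simp

theorem closure_a_b :
    Subgroup.closure {genElt u .a, genElt u .b} = transHom.range := by
  refine closure_map_pair _ ?_
  rw [← closure_vec_two, ← Subgroup.closure_inv]
  congr 1
  simp [Set.inv_insert, ← ofAdd_neg]

theorem closure_c_d :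
    Subgroup.closure {genElt u .c, genElt u .d} = shearHom.range :=
  closure_map_pair _ closure_vec_two

theorem units_matrix_eq (P : (Matrix (Fin 1) (Fin 1) (ZMod 3))ˣ) : P = 1 ∨ P = -1 := by
  have h := congrFun (congrFun P.mul_inv 0) 0
  rw [Matrix.mul_apply, Fin.sum_univ_one, Matrix.one_apply_eq] at h
  have key : ∀ x y : ZMod 3, x * y = 1 → x = 1 ∨ x = -1 := by decide
  refine (key _ _ h).imp (fun h => ?_) fun h => ?_
  · ext a b; fin_cases a; fin_cases b; simpa using h
  · ext a b; fin_cases a; fin_cases b; simpa using h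

theorem closure_elem : Subgroup.closure
    {elemElt (fun _ : Fin 1 => (-1 : ZMod 3)) 1, elemElt 0 (-1)} = ⊤ := by
  rw [eq_top_iff]
  rintro q -
  obtain ⟨l, P, rfl⟩ := exists_elt (vecEquiv 3 1) (vecEnd 3 1) q
  rw [← elt_one_mul_elt_zero]
  refine mul_mem ?_ ?_
  · have h : elemElt (fun _ : Fin 1 => (-1 : ZMod 3)) 1 ^ (-((l 0).val : ℤ)) = elemElt l 1 := by
      rw [elt_one_zpow, elt_inj]
      refine ⟨?_, rfl⟩
      ext i
      fin_cases i
      simp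
    change elemElt l 1 ∈ _
    rw [← h]
    exact zpow_mem (Subgroup.subset_closure (Set.mem_insert _ _)) _
  · rcases units_matrix_eq P with rfl | rfl
    · rw [elt_zero_one]; exact one_mem _
    · exact Subgroup.subset_closure (Set.mem_insert_of_mem _ rfl)

theorem closure_e1_f1 :
    Subgroup.closure {genElt u .e1, genElt u .f1} = sectionHom.range :=
  closure_map_pair _ closure_elem

variable {u}

theorem closure_cyc (hu : ∀ v, v ∈ Subgroup.zpowers u) : Subgroup.closure
    {cycElt (3 ^ (k + 2)) 1 1, cycElt _ 0 u⁻¹} = ⊤ := by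
  rw [eq_top_iff]
  rintro q -
  obtain ⟨s, a, rfl⟩ := exists_elt (MulEquiv.refl _) (zmodEnd _) q
  rw [← elt_one_mul_elt_zero]
  refine mul_mem ?_ ?_
  · have h : cycElt (3 ^ (k + 2)) 1 1 ^ s.val = cycElt _ s 1 := by
      rw [elt_one_pow, elt_inj]
      simp
    change cycElt _ s 1 ∈ _
    rw [← h]
    exact pow_mem (Subgroup.subset_closure (Set.mem_insert _ _)) _
  · obtain ⟨i, rfl⟩ := hu a
    have h : cycElt (3 ^ (k + 2)) 0 u⁻¹ ^ (-i) = cycElt _ 0 (u ^ i) := by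
      rw [elt_zero_zpow, inv_zpow, zpow_neg, inv_inv]
    have hm : cycElt (3 ^ (k + 2)) 0 u⁻¹ ∈
        Subgroup.closure {cycElt (3 ^ (k + 2)) 1 1, cycElt _ 0 u⁻¹} :=
      Subgroup.subset_closure (Set.mem_insert_of_mem _ (Set.mem_singleton _))
    have hz := zpow_mem hm (-i)
    rwa [h] at hz

theorem closure_e_f (hu : ∀ v, v ∈ Subgroup.zpowers u) :
    Subgroup.closure {genElt u .e, genElt u .f} = scalarHom.range :=
  closure_map_pair scalarHom (closure_cyc hu)

end Generation

theorem zpow_eq_one_of_cast {G : Type*} [Group G] {x : G} {N : ℕ} (hx : x ^ N = 1) {r : ℤ}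
    (hr : (r : ZMod N) = 0) : x ^ r = 1 := by
  obtain ⟨l, rfl⟩ := (ZMod.intCast_zmod_eq_zero_iff_dvd r N).1 hr
  rw [zpow_mul, zpow_natCast, hx, one_zpow]

/-- Elements of `K` have no component in the translations along `1^n` or in `col`, so only the
cyclic parts of `A` and `B` can meet `K`. -/
theorem trans_shear_scalar_eq_one {p n : ℕ} [Fact p.Prime] {z w : Multiplicative (Vec p (n + 1))}
    {s : ZMod (p ^ (k + 2))} {a : (ZMod (p ^ (k + 2)))ˣ}
    (h : transHom z * shearHom w * scalarHom (cycElt _ s a) = 1) :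
    Fin.tail z.toAdd = 0 ∧ Fin.tail w.toAdd = 0 := by
  rw [scalarHom_elt] at h
  change baseElt _ _ * baseElt _ _ * baseElt _ _ = _ at h
  rw [elt_mul, elt_mul, elt_eq_one] at h
  obtain ⟨h1, h2⟩ := h
  have hw : Fin.tail w.toAdd = 0 := by
    have hc := congrArg (fun c : (Coef p k n)ˣ => c.val.col) h2
    have ha : red p k a.val ≠ 0 := fun h0 => by
      have := red_mul_red_inv a
      rw [h0, zero_mul] at this
      exact zero_ne_one this
    simpa [shearCoef_val, scalarCoef, ha] using hc
  refine ⟨?_, hw⟩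
  simpa [shearCoef_val, hw] using congrArg Prod.snd h1

theorem scalarHom_eq_one {p n : ℕ} [Fact p.Prime] {s : ZMod (p ^ (k + 2))}
    {a : (ZMod (p ^ (k + 2)))ˣ} (h : scalarHom (n := n) (cycElt _ s a) = 1) : s = 0 ∧ a = 1 := by
  rw [scalarHom_elt, elt_eq_one] at h
  exact ⟨congrArg Prod.fst h.1, Units.ext (congrArg (fun c : (Coef p k n)ˣ => c.val.scale) h.2)⟩

theorem map_kerWord {G : Type} [Group G] {g : Gen → G} {u : (ZMod (3 ^ (k + 2)))ˣ}
    {φ : G →* Hol (Base 3 (k + 2) 1)} (hφ : ∀ t, φ (g t) = genElt u t) (w x y z : ℤ) :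
    φ (kerWord g w x y z) =
      transHom (.ofAdd ![-(x : ZMod 3), -(w : ZMod 3)]) *
        shearHom (.ofAdd ![(z : ZMod 3), y]) := by
  have h1 : (Multiplicative.ofAdd ![0, -1] ^ w * .ofAdd ![-1, 0] ^ x : Multiplicative (Vec 3 2)) =
      .ofAdd ![-(x : ZMod 3), -(w : ZMod 3)] := by
    rw [← ofAdd_zsmul, ← ofAdd_zsmul, ← ofAdd_add]
    congr 1
    ext i
    fin_cases i <;> simp
  have h2 : (Multiplicative.ofAdd ![0, 1] ^ y * .ofAdd ![1, 0] ^ z : Multiplicative (Vec 3 2)) =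
      .ofAdd ![(z : ZMod 3), y] := by
    rw [← ofAdd_zsmul, ← ofAdd_zsmul, ← ofAdd_add]
    congr 1
    ext i
    fin_cases i <;> simp
  rw [← h1, ← h2]
  simp only [kerWord, map_mul, map_zpow, hφ, genElt, mul_assoc]

theorem map_elemWord {G : Type} [Group G] {g : Gen → G} {u : (ZMod (3 ^ (k + 2)))ˣ}
    {φ : G →* Hol (Base 3 (k + 2) 1)} (hφ : ∀ t, φ (g t) = genElt u t) (r s : ℤ) :
    φ (g .e1 ^ r * g .f1 ^ s) = sectionHom (elemElt (fun _ => (-r : ZMod 3)) ((-1) ^ s)) := by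
  simp only [map_mul, map_zpow, hφ, genElt]
  simp only [← map_zpow, ← map_mul]
  rw [elt_one_zpow, elt_zero_zpow, elt_one_mul_elt_zero]
  congr 2
  ext
  simp

theorem map_cycWord {G : Type} [Group G] {g : Gen → G} {u : (ZMod (3 ^ (k + 2)))ˣ}
    {φ : G →* Hol (Base 3 (k + 2) 1)} (hφ : ∀ t, φ (g t) = genElt u t) (x y : ℤ) :
    φ (g .e ^ x * g .f ^ y) = scalarHom (cycElt _ (x : ZMod (3 ^ (k + 2))) (u⁻¹ ^ y)) := by
  simp only [map_mul, map_zpow, hφ, genElt]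
  simp only [← map_zpow, ← map_mul]
  rw [elt_one_zpow, elt_zero_zpow, elt_one_mul_elt_zero]
  congr 2
  simp

/-- The projection to `Hol(1^n)` kills the `e1, f1` part; the `1^n`-coordinates kill the powers of
`a` and `c`. What remains is a word in `b, d, e, f`, where `b` and `d` are powers of `e` and `f`,
and `Hol(C_y)` embeds. -/
theorem GenRelations.eq_one_of_map {G : Type} [Group G] {g : Gen → G}
    {u : (ZMod (3 ^ (k + 2)))ˣ} {i : ℤ} {j : ℕ} (hord : orderOf u = 2 * 3 ^ (k + 1))
    (h : GenRelations (k + 2) i j g)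
    {φ : G →* Hol (Base 3 (k + 2) 1)} (hφ : ∀ t, φ (g t) = genElt u t) {v : G}
    (hv : v ∈ h.normalForms) (hv1 : φ v = 1) : v = 1 := by
  obtain ⟨_, ⟨w, x, y, z, rfl⟩, r, s, x', y', rfl⟩ := hv
  have hH : g .e1 ^ r * g .f1 ^ s = 1 := by
    have hq := congrArg (fun v => (proj v).1) hv1
    simp only [map_mul φ (kerWord _ _ _ _ _ * _), map_mul φ (kerWord _ _ _ _ _),
      map_kerWord hφ, map_elemWord hφ, map_cycWord hφ, map_mul proj, proj_transHom, proj_shearHom,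
      proj_sectionHom, proj_scalarHom, map_one] at hq
    simp only [one_mul, mul_one, Prod.mk_mul_mk, Prod.fst_one, elt_eq_one] at hq
    obtain ⟨hr, hs⟩ := hq
    have hr' : (r : ZMod 3) = 0 := by simpa using congrFun hr 0
    rw [zpow_eq_one_of_cast h.e1_pow hr', one_mul]
    obtain ⟨l, rfl⟩ | hodd := Int.even_or_odd s
    · rw [← two_mul, zpow_mul]
      exact (congrArg (· ^ l) (by exact_mod_cast h.f1_pow)).trans (one_zpow l)
    · rw [hodd.neg_one_zpow] at hs
      have := congrArg (fun c : (Matrix (Fin 1) (Fin 1) (ZMod 3))ˣ => c.val 0 0) hs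
      simp only [Units.val_neg, Units.val_one, Matrix.neg_apply, Matrix.one_apply_eq] at this
      exact absurd this (by decide)
  rw [hH, mul_one] at hv1 ⊢
  have hz := hv1
  rw [map_mul, map_kerWord hφ, map_cycWord hφ] at hz
  obtain ⟨h1, h2⟩ := trans_shear_scalar_eq_one hz
  have hw : (w : ZMod 3) = 0 := by simpa [Fin.tail] using congrFun h1 0
  have hy : (y : ZMod 3) = 0 := by simpa [Fin.tail] using congrFun h2 0
  rw [kerWord, zpow_eq_one_of_cast h.a_pow hw, zpow_eq_one_of_cast h.c_pow hy, one_mul,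
    one_mul] at hv1 ⊢
  have hb : g .b = (g .e ^ 3 ^ (k + 1))⁻¹ := inv_eq_iff_eq_inv.1 h.e_pow_b.symm
  -- Conjugation by `d ^ z` carries this power to the right end, where it merges with the power of
  -- `f`; `b` is absorbed into the power of `e`.
  have hconj : (g .d ^ z)⁻¹ * (g .b ^ x * g .d ^ z * (g .e ^ x' * g .f ^ y')) * g .d ^ z =
      g .e ^ (-3 ^ (k + 1) * x + x') * g .f ^ (y' + j * z) := by
    have hbd : Commute (g .b) (g .d) := h.b_d
    rw [(hbd.zpow_zpow x z).eq, mul_assoc (g .d ^ z), inv_mul_cancel_left, zpow_add,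
      zpow_add, zpow_mul, zpow_mul (g .f), zpow_neg]
    have h3 : g .e ^ (3 ^ (k + 1) : ℤ) = g .e ^ 3 ^ (k + 1) := by exact_mod_cast rfl
    rw [h3, ← hb, zpow_natCast, ← h.d_eq]
    simp only [mul_assoc]
  have hone : g .e ^ (-3 ^ (k + 1) * x + x') * g .f ^ (y' + j * z) = 1 := by
    have hX : φ (g .e ^ (-3 ^ (k + 1) * x + x') * g .f ^ (y' + j * z)) = 1 := by
      rw [← hconj, map_mul, map_mul, hv1, mul_one, ← map_mul, inv_mul_cancel, map_one]
    rw [map_cycWord hφ] at hX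
    obtain ⟨hX1, hX2⟩ := scalarHom_eq_one hX
    rw [zpow_eq_one_of_cast h.e_pow hX1, one_mul]
    rw [inv_zpow, inv_eq_one, ← orderOf_dvd_iff_zpow_eq_one, hord] at hX2
    exact zpow_eq_one_of_cast h.f_pow ((ZMod.intCast_zmod_eq_zero_iff_dvd _ _).2 hX2)
  rw [hone, mul_assoc, inv_mul_eq_one] at hconj
  simpa using hconj

theorem lift_of {α : Type*} (rels : Set (FreeGroup α)) (w : FreeGroup α) :
    FreeGroup.lift (PresentedGroup.of (rels := rels)) w = PresentedGroup.mk rels w :=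
  DFunLike.congr_fun (FreeGroup.ext_hom _ _ fun _ => FreeGroup.lift_apply_of) w

/-- The hypothesis `hi` gives the relation for `e^f`, `hu` makes `f` invert `a` and `b`, and `huj`
makes `f ^ j` equal to `d`. -/
theorem isPresentation {u : (ZMod (3 ^ (k + 2)))ˣ} {i : ℤ} {j : ℕ}
    (hi : (u : ZMod (3 ^ (k + 2))) = -i) (hu : red 3 k u = -1) (hj : 2 * 3 ^ k ∣ j)
    (huj : (u : ZMod (3 ^ (k + 2))) ^ j = 1 - incl 3 k 1) : IsPresentation (k + 2) i j := by
  have hord := orderOf_eq u hu hj huj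
  have hrel := genRelations_genElt hi hu hord huj
  have hgen : GenRelations (k + 2) i j (PresentedGroup.of (rels := relators (k + 2) i j)) := by
    refine genRelations_iff.1 fun r hr => ?_
    rw [← PresentedGroup.one_of_mem hr]
    exact lift_of _ r
  let φ := PresentedGroup.toGroup (genRelations_iff.2 hrel)
  have hφ (t : Gen) : φ (PresentedGroup.of t) = genElt u t := PresentedGroup.toGroup.of _
  have hdec : IsDecomposition 3 (k + 2) 1
      (Subgroup.closure {φ (PresentedGroup.of Gen.a), φ (PresentedGroup.of Gen.b)})
      (Subgroup.closure {φ (PresentedGroup.of Gen.c), φ (PresentedGroup.of Gen.d)})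
      (Subgroup.closure {φ (PresentedGroup.of Gen.e1), φ (PresentedGroup.of Gen.f1)})
      (Subgroup.closure {φ (PresentedGroup.of Gen.e), φ (PresentedGroup.of Gen.f)}) := by
    simp only [hφ, closure_a_b, closure_c_d, closure_e1_f1,
      closure_e_f (mem_zpowers_of_orderOf hord)]
    exact isDecomposition_range (by decide)
  have hle (s t : Gen) : Subgroup.closure {φ (PresentedGroup.of s), φ (PresentedGroup.of t)} ≤
      φ.range := by
    rw [Subgroup.closure_le]
    rintro _ (rfl | rfl) <;> exact ⟨_, rfl⟩
  have hsurj : Function.Surjective φ := by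
    intro v
    obtain ⟨π, -, hker, hH, hK, -⟩ := hdec.exists_quotient
    obtain ⟨x, hx, hx'⟩ := hH.surjOn (show ((π v).1, 1) ∈ {x : Hol _ × Hol _ | x.2 = 1} from rfl)
    obtain ⟨y, hy, hy'⟩ := hK (show (1, (π v).2) ∈ {x : Hol _ × Hol _ | x.1 = 1} from rfl)
    -- Modulo the kernel `A ⊔ B`, which lies in the range, `v` is a product of elements of `H` and
    -- `K`.
    have hn : v * (x * y)⁻¹ ∈ φ.range := by
      have : v * (x * y)⁻¹ ∈ π.ker := by
        rw [MonoidHom.mem_ker, map_mul, map_inv, map_mul, hx', hy', mul_inv_eq_one]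
        simp
      rw [hker] at this
      exact sup_le (hle _ _) (hle _ _) this
    have := mul_mem hn (mul_mem (hle _ _ hx) (hle _ _ hy))
    rwa [inv_mul_cancel_right] at this
  have hinj : Function.Injective φ := by
    rw [injective_iff_map_eq_one]
    intro v hv
    refine hgen.eq_one_of_map hord hφ ?_ hv
    obtain ⟨r, rfl⟩ := PresentedGroup.mk_surjective _ v
    have := hgen.lift_mem r
    rwa [lift_of] at this
  exact ⟨MulEquiv.ofBijective φ ⟨hinj, hsurj⟩, hdec⟩

theorem isPresentation_four (k : ℕ) : IsPresentation (k + 2) 4 (2 * 3 ^ k) := by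
  let u : (ZMod (3 ^ (k + 2)))ˣ :=
    -ZMod.unitOfCoprime 4 (Nat.Coprime.pow_right _ (by norm_num))
  have hu : (u : ZMod (3 ^ (k + 2))) = -4 := by simp [u]
  refine isPresentation (u := u) (by rw [hu]; norm_num) ?_ dvd_rfl ?_
  · rw [hu, map_neg, map_ofNat]; decide
  · rw [hu, pow_mul, incl_one, ← sixteen_pow]; norm_num

theorem isPresentation_neg_two (k : ℕ) : IsPresentation (k + 2) (-2) (4 * 3 ^ k) := by
  let u : (ZMod (3 ^ (k + 2)))ˣ :=
    ZMod.unitOfCoprime 2 (Nat.Coprime.pow_right _ (by norm_num))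
  have hu : (u : ZMod (3 ^ (k + 2))) = 2 := by simp [u]
  refine isPresentation (u := u) (by rw [hu]; norm_num) ?_ ⟨2, by ring⟩ ?_
  · rw [hu, map_ofNat]; decide
  · rw [hu, pow_mul, incl_one, ← sixteen_pow]; norm_num

end Holomorph

theorem mainTheorem6 :
    (∀ p m n : ℕ, p.Prime → p ≠ 2 → 2 ≤ m →
      ∃ A B H K : Subgroup (Holomorph.Hol (Holomorph.Base p m n)),
        Holomorph.IsDecomposition p m n A B H K) ∧
    (∀ m : ℕ, 2 ≤ m →
      Holomorph.IsPresentation m 4 (2 * 3 ^ (m - 2)) ∧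
      Holomorph.IsPresentation m (-2) (4 * 3 ^ (m - 2))) := by
  refine ⟨fun p m n hp hp2 hm => ?_, fun m hm => ?_⟩
  · obtain ⟨k, rfl⟩ := Nat.exists_eq_add_of_le' hm
    have : Fact p.Prime := ⟨hp⟩
    exact ⟨_, _, _, _, Holomorph.isDecomposition_range hp2⟩
  · obtain ⟨k, rfl⟩ := Nat.exists_eq_add_of_le' hm
    exact ⟨Holomorph.isPresentation_four k, Holomorph.isPresentation_neg_two k⟩
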